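/- There is a polynomial-time approximation scheme (PTAS) for max-sum diversification with negative-type distances subject to a matroid intersection constraint, in the following sense. An instance consists of a finite ground set $X=\{0,\dots,n-1\}$, a function $d:X\times X\to\mathbb{R}_{\ge 0}$ with $d(a,b)=d(b,a)$ and $d(a,a)=0$ (not necessarily satisfying the triangle inequality) that is of negative type, i.e. $\sum_{a,b\in X}x_a\,d(a,b)\,x_b\le 0$ for all $x\in\mathbb{R}^X$ with $\sum_{a\in X} x_a=0$, and two matroids $M_1=(X,\mathcal I_1)$, $M_2=(X,\mathcal I_2)$. The dispersion of $A\subseteq X$ is $d(A)=\sum_{\{a,b\}\subseteq A}d(a,b)$, and the problem is to maximize $d(A)$ over $A\in\mathcal I_1\cap\mathcal I_2$. There is a single deterministic algorithm which receives $n$ and a real number $\epsilon>0$, has access to the instance only through an oracle for the distances $d(a,b)$ and an independence oracle for each of $M_1,M_2$, and satisfies the following. For every fixed $\epsilon>0$ there is a polynomial $T_\epsilon$ such that on every instance with $n$ elements the algorithm halts after at most $T_\epsilon(n)$ steps and returns a set $A\in\mathcal I_1\cap\mathcal I_2$ with \[ d(A)\;\ge\;(1-\epsilon)\max\{d(B)\mid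 B\in\mathcal I_1\cap\mathcal I_2\}. \] Here an algorithm is a program for a random access machine with natural-number and real registers and arrays, whose only operations are loading the constants (natural numbers, and the real number $1$), copying, array access, addition, subtraction and comparison, together with the oracle calls; every operation and every oracle call counts as one step. -/

import Mathlib

namespace MaxSumDiv

/-! ## Distances, negative type, dispersion -/

/-- A distance function: symmetric, nonnegative and zero on the diagonal.
The triangle inequality is not required. -/
structure IsDistance {X : Type*} (d : X → X → ℝ) : Prop where
  symm : ∀ a b, d a b = d b a
  nonneg : ∀ a b, 0 ≤ d a b
  self : ∀ a, d a a = 0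

/-- `d` is of negative type: `xᵀ D x ≤ 0` for every vector `x` whose entries sum to zero. -/
def IsNegativeType {X : Type*} [Fintype X] (d : X → X → ℝ) : Prop :=
  ∀ x : X → ℝ, ∑ a, x a = 0 → ∑ a, ∑ b, x a * d a b * x b ≤ 0

/-- The dispersion of `A`: the sum of `d a b` over all unordered pairs of elements of `A`. Each
pair is met twice in the double sum, and the diagonal contributes zero. -/
noncomputable def dispersion {X : Type*} (d : X → X → ℝ) (A : Finset X) : ℝ :=
  (1 / 2) * ∑ a ∈ A, ∑ b ∈ A, d a b

/-- `A` is independent in both matroids. -/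
def CommonIndep {X : Type*} (M₁ M₂ : Matroid X) (A : Finset X) : Prop :=
  M₁.Indep (A : Set X) ∧ M₂.Indep (A : Set X)

/-- `A` is a feasible solution whose dispersion is at least `1 - ε` times that of every feasible
solution. -/
def IsApproxSolution {X : Type*} (d : X → X → ℝ) (M₁ M₂ : Matroid X) (ε : ℝ) (A : Finset X) :
    Prop :=
  CommonIndep M₁ M₂ A ∧
    ∀ B : Finset X, CommonIndep M₁ M₂ B → (1 - ε) * dispersion d B ≤ dispersion d A

/-! ## Oracle random access machine

Programs are finite syntactic objects working on natural-number registers and arrays and on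
real registers and arrays. The only arithmetic is addition and subtraction (no multiplication, so
that unit cost cannot be abused), the only real constant is `1`, and the only tests are order
comparisons. The instance is accessible only through its size, a distance oracle and one
independence oracle per matroid. Each instruction, each test and each oracle call costs one
step. -/

/-- Elementary instructions. Arguments are names of registers or arrays. -/
inductive Instr : Type
  /-- natural register `x` gets the constant `c` -/
  | const (x c : ℕ)
  /-- natural register `x` gets the value of register `y` -/
  | copy (x y : ℕ)
  /-- natural register `x` gets the sum of registers `y` and `z` -/
  | add (x y z : ℕ)
  /-- natural register `x` gets the truncated difference of registers `y` and `z` -/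
  | sub (x y z : ℕ)
  /-- natural register `x` gets the entry of array `a` at the index held in register `i` -/
  | load (x a i : ℕ)
  /-- the entry of array `a` at the index held in register `i` gets the value of register `y` -/
  | store (a i y : ℕ)
  /-- real register `x` gets the constant `1` -/
  | rone (x : ℕ)
  /-- real register `x` gets the value of real register `y` -/
  | rcopy (x y : ℕ)
  /-- real register `x` gets the sum of real registers `y` and `z` -/
  | radd (x y z : ℕ)
  /-- real register `x` gets the difference of real registers `y` and `z` -/
  | rsub (x y z : ℕ)
  /-- real register `x` gets the entry of real array `a` at the index held in register `i` -/
  | rload (x a i : ℕ)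
  /-- the entry of real array `a` at the index held in register `i` gets real register `y` -/
  | rstore (a i y : ℕ)
  /-- real register `x` gets the distance of the two elements whose numbers are held in the
  natural registers `i` and `j` -/
  | dist (x i j : ℕ)
  /-- natural register `x` gets `1` if the set whose indicator is held in array `a` is independent
  in the first matroid, and `0` otherwise -/
  | indep₁ (x a : ℕ)
  /-- the same for the second matroid -/
  | indep₂ (x a : ℕ)

/-- Tests: strict comparison of two natural registers or of two real registers. -/
inductive Test : Type
  | lt (x y : ℕ)
  | rlt (x y : ℕ)

/-- Structured programs: `loop c p` repeats `p` as long as `c` holds. -/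
inductive Prog : Type
  | instr (i : Instr)
  | seq (p q : Prog)
  | ite (c : Test) (p q : Prog)
  | loop (c : Test) (p : Prog)

/-- Memory contents. -/
structure State : Type where
  /-- natural-number registers -/
  nat : ℕ → ℕ
  /-- natural-number arrays -/
  arr : ℕ → ℕ → ℕ
  /-- real registers -/
  real : ℕ → ℝ
  /-- real arrays -/
  rarr : ℕ → ℕ → ℝ

/-- The subset of `{0, …, n - 1}` whose indicator is held in array `a`; an element belongs to it
when the corresponding entry is nonzero. -/
def State.setOf (n : ℕ) (s : State) (a : ℕ) : Finset (Fin n) :=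
  Finset.univ.filter fun v : Fin n => s.arr a v ≠ 0

/-- The distance oracle on numbers of elements; it answers `0` to a number out of range. -/
noncomputable def distOracle {n : ℕ} (d : Fin n → Fin n → ℝ) (i j : ℕ) : ℝ :=
  if h : i < n ∧ j < n then d ⟨i, h.1⟩ ⟨j, h.2⟩ else 0

open Classical in
/-- The independence oracle. -/
noncomputable def indepOracle {n : ℕ} (M : Matroid (Fin n)) (S : Finset (Fin n)) : ℕ :=
  if M.Indep (S : Set (Fin n)) then 1 else 0

/-- Effect of one instruction. -/
noncomputable def Instr.run {n : ℕ} (d : Fin n → Fin n → ℝ) (M₁ M₂ : Matroid (Fin n)) :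
    Instr → State → State
  | .const x c, s => { s with nat := Function.update s.nat x c }
  | .copy x y, s => { s with nat := Function.update s.nat x (s.nat y) }
  | .add x y z, s => { s with nat := Function.update s.nat x (s.nat y + s.nat z) }
  | .sub x y z, s => { s with nat := Function.update s.nat x (s.nat y - s.nat z) }
  | .load x a i, s => { s with nat := Function.update s.nat x (s.arr a (s.nat i)) }
  | .store a i y, s =>
      { s with arr := Function.update s.arr a (Function.update (s.arr a) (s.nat i) (s.nat y)) }
  | .rone x, s => { s with real := Function.update s.real x 1 }
  | .rcopy x y, s => { s with real := Function.update s.real x (s.real y) }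
  | .radd x y z, s => { s with real := Function.update s.real x (s.real y + s.real z) }
  | .rsub x y z, s => { s with real := Function.update s.real x (s.real y - s.real z) }
  | .rload x a i, s => { s with real := Function.update s.real x (s.rarr a (s.nat i)) }
  | .rstore a i y, s =>
      { s with rarr := Function.update s.rarr a (Function.update (s.rarr a) (s.nat i) (s.real y)) }
  | .dist x i j, s =>
      { s with real := Function.update s.real x (distOracle d (s.nat i) (s.nat j)) }
  | .indep₁ x a, s => { s with nat := Function.update s.nat x (indepOracle M₁ (s.setOf n a)) }
  | .indep₂ x a, s => { s with nat := Function.update s.nat x (indepOracle M₂ (s.setOf n a)) }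

/-- Truth value of a test. -/
def Test.holds : Test → State → Prop
  | .lt x y, s => s.nat x < s.nat y
  | .rlt x y, s => s.real x < s.real y

/-- `Exec d M₁ M₂ p s s' t`: on the instance `d, M₁, M₂`, program `p` started in memory `s` halts
in memory `s'` after exactly `t` steps. -/
inductive Exec {n : ℕ} (d : Fin n → Fin n → ℝ) (M₁ M₂ : Matroid (Fin n)) :
    Prog → State → State → ℕ → Prop
  | instr (i : Instr) (s : State) : Exec d M₁ M₂ (.instr i) s (i.run d M₁ M₂ s) 1
  | seq {p q : Prog} {s s' s'' : State} {t t' : ℕ} (hp : Exec d M₁ M₂ p s s' t)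
      (hq : Exec d M₁ M₂ q s' s'' t') : Exec d M₁ M₂ (.seq p q) s s'' (t + t')
  | ite_true {c : Test} {p q : Prog} {s s' : State} {t : ℕ} (hc : c.holds s)
      (hp : Exec d M₁ M₂ p s s' t) : Exec d M₁ M₂ (.ite c p q) s s' (t + 1)
  | ite_false {c : Test} {p q : Prog} {s s' : State} {t : ℕ} (hc : ¬ c.holds s)
      (hq : Exec d M₁ M₂ q s s' t) : Exec d M₁ M₂ (.ite c p q) s s' (t + 1)
  | loop_stop {c : Test} {p : Prog} {s : State} (hc : ¬ c.holds s) :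
      Exec d M₁ M₂ (.loop c p) s s 1
  | loop_step {c : Test} {p : Prog} {s s' s'' : State} {t t' : ℕ} (hc : c.holds s)
      (hp : Exec d M₁ M₂ p s s' t) (hl : Exec d M₁ M₂ (.loop c p) s' s'' t') :
      Exec d M₁ M₂ (.loop c p) s s'' (t + t' + 1)

/-- Initial memory: the size `n` in natural register `0`, the error parameter `ε` in real
register `0`, and zeros everywhere else. -/
noncomputable def initState (n : ℕ) (ε : ℝ) : State where
  nat := fun x => if x = 0 then n else 0
  arr := fun _ _ => 0
  real := fun x => if x = 0 then ε else 0
  rarr := fun _ _ => 0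

/-- The set returned by a halted program: the one whose indicator is held in array `0`. -/
def State.output (n : ℕ) (s : State) : Finset (Fin n) :=
  s.setOf n 0

end MaxSumDiv

/-!
Write `D A B` for the sum of all distances between `A` and `B` (`crossSum`), so that `D A A` is
twice the dispersion. The algorithm is local search: starting from the empty set, it moves
`(n + 1) ^ K` times to the best common independent set at Hamming distance at most
`K = 6 * p * (p + 1)` from the current one, where `p` is the least number with `p * ε ≥ 8`.

*Linear objectives.* For an independent set `A`, the elements to be added and those to be removed
are joined by the exchange relation of each of the two matroids. Each relation contains a perfect
matching of the symmetric difference of `A` and `B` with itself (`exists_perm_exchangeable`, Hall),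
and two matchings form alternating cycles. Among all alternating cycles take one of maximal weight
per length, and a shortest one among these. An exchangeable pair outside such a cycle would be a
shortcut to a shorter cycle of smaller density, so the prefix sums of the excess weight are a
potential that strictly increases along it (`IsExtremalCycle.exists_potential`). A potential makes
the matchings of the cycle unique on each of their parts, so any part of the cycle can be exchanged
in both matroids (`indep_exchange_of_potential`). Cutting the cycle into segments that add `p` and
remove `p + 1` elements gives `exists_bounded_exchange`: if no bounded exchange improves a linear
objective much, then `A` is optimal up to a factor close to `1 + 1 / p`.

*Dispersion.* Negative type gives `d a b ≤ 2 * (d a c + d c b)` and `D A A * D B B ≤ (D A B) ^ 2`.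
By the first inequality the quadratic terms of a bounded exchange are negligible when `A` is large,
so the change of `D A A` is governed by the linear weights `y ↦ ∑ c ∈ A, d y c`, and a local optimum
satisfies `D A B ≤ (1 + O(1 / p)) * D A A`. By the second one, `D B B ≤ (1 + O(1 / p)) * D A A`.
If `A` is small, either `B` is itself a neighbour of `A`, or an element of `B` can be added to `A`
in both matroids, which increases `D A A` by a constant factor. Altogether a set which is not nearly
optimal has a neighbour better by a factor `1 + 1 / (K * n)` (`exists_improving_neighbour`). The
first round is within a factor `n ^ 2` of the optimum, because it is at least as good as every pair,
so `K * n ^ 3` further rounds suffice (`LocalSearch.isApproxSolution`).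

*Program.* A neighbour is encoded by a number below `(n + 1) ^ K`, whose base `n + 1` digits are the
elements to be toggled, the digit `n` standing for none (`exists_digitSet_eq`). The correctness and
the running time of the program are derived from rules for the predicate `Runs`.
-/

namespace MaxSumDiv

/-! ### Exchanges in one matroid -/

/-- The exchange relation of an independent set `A`: adding `b` to `A` and removing `a` keeps
independence. Neither `b ∉ A` nor `a ∈ A` is required. An element `b ∈ A` is related to everything,
so it serves as a dummy to be added, and an element `a ∉ A` is related exactly to those `b` for
which `insert b A` is independent, so it serves as a dummy to be removed. -/
def Exchangeable {V : Type*} (M : Matroid V) (A : Finset V) (b a : V) : Prop :=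
  M.Indep (insert b ((A : Set V) \ {a}))

lemma exchangeable_of_mem {V : Type*} {M : Matroid V} {A : Finset V} (hA : M.Indep (A : Set V))
    {b : V} (hb : b ∈ A) (a : V) : Exchangeable M A b a :=
  hA.subset (Set.insert_subset (by simpa using hb) Set.sdiff_subset)

lemma exchangeable_of_indep_insert {V : Type*} {M : Matroid V} {A : Finset V} {b : V}
    (hb : M.Indep (insert b (A : Set V))) (a : V) : Exchangeable M A b a :=
  hb.subset (Set.insert_subset_insert Set.sdiff_subset)

/-- Hall's condition holds for the exchange relation: the symmetric difference of two independent
sets, used both as the set of elements to be added and as that of elements to be removed, is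
perfectly matched. Thanks to the dummies the two sets need not have the same size. -/
lemma exists_perm_exchangeable {V : Type*} [DecidableEq V] {M : Matroid V}
    {A B : Finset V} (hE : M.E = Set.univ) (hA : M.Indep (A : Set V)) (hB : M.Indep (B : Set V)) :
    ∃ f : Equiv.Perm (symmDiff A B : Finset V),
      ∀ b : (symmDiff A B : Finset V), Exchangeable M A (b : V) (f b : V) := by
  classical
  set Y : Finset V := symmDiff A B with hY
  let t : Y → Finset V := fun b => Y.filter fun a => Exchangeable M A b a
  have hall : ∀ s : Finset Y, s.card ≤ (s.biUnion t).card := by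
    intro s
    by_cases hfull : ∃ b ∈ s, (b : V) ∈ A ∨ M.Indep (insert (b : V) (A : Set V))
    · obtain ⟨b, hbs, hb⟩ := hfull
      have hsub : Y ⊆ s.biUnion t := by
        intro a ha
        refine Finset.mem_biUnion.2 ⟨b, hbs, Finset.mem_filter.2 ⟨ha, ?_⟩⟩
        rcases hb with hb | hb
        · exact exchangeable_of_mem hA hb a
        · exact exchangeable_of_indep_insert hb a
      calc s.card ≤ Fintype.card Y := Finset.card_le_univ s
        _ = Y.card := Fintype.card_coe Y
        _ ≤ _ := Finset.card_le_card hsub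
    · push Not at hfull
      by_contra! hlt
      set S : Finset V := s.map (Function.Embedding.subtype _) with hS
      have hSB : ∀ b ∈ S, b ∈ B ∧ b ∉ A := by
        intro b hb
        obtain ⟨b', hb', rfl⟩ := Finset.mem_map.1 hb
        have h1 := (hfull b' hb').1
        have h2 := Finset.mem_symmDiff.1 b'.2
        exact ⟨by simpa [h1] using h2, h1⟩
      -- The elements of `A` exchangeable with some element of `s`, and the common elements.
      set F : Finset V := (s.biUnion t ∩ A) ∪ (A ∩ B) with hF
      have hFA : F ⊆ A := by
        intro x hx
        simp only [hF, Finset.mem_union, Finset.mem_inter] at hx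
        tauto
      have hcard : F.card < (S ∪ (A ∩ B)).card := by
        have hdis : Disjoint S (A ∩ B) := by
          rw [Finset.disjoint_left]
          intro x hx hx'
          exact (hSB x hx).2 (Finset.mem_inter.1 hx').1
        rw [Finset.card_union_of_disjoint hdis]
        have h1 : F.card ≤ (s.biUnion t).card + (A ∩ B).card :=
          (Finset.card_union_le _ _).trans
            (Nat.add_le_add_right (Finset.card_le_card Finset.inter_subset_left) _)
        have h2 : S.card = s.card := Finset.card_map _
        omega
      have hJ : M.Indep ((S ∪ (A ∩ B) : Finset V) : Set V) := by
        refine hB.subset ?_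
        intro x hx
        rcases Finset.mem_union.1 (Finset.mem_coe.1 hx) with h | h
        · exact (hSB x h).1
        · exact (Finset.mem_inter.1 h).2
      obtain ⟨b, hbJ, hbF, hbi⟩ :=
        (hA.subset (Finset.coe_subset.2 hFA)).augment_finset hJ hcard
      have hbS : b ∈ S := by
        rcases Finset.mem_union.1 hbJ with h | h
        · exact h
        · exact absurd (Finset.mem_union_right _ h) hbF
      obtain ⟨b', hb', rfl⟩ := Finset.mem_map.1 hbS
      have hbA := (hfull b' hb').1
      have hcl : (b' : V) ∈ M.closure (A : Set V) := by
        by_contra hcl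
        exact (hfull b' hb').2 ((hA.notMem_closure_iff (by simp [hE])).1 hcl).1
      have hC := hA.fundCircuit_isCircuit hcl (by simpa using hbA)
      refine hC.not_indep (hbi.subset ?_)
      intro a ha
      by_cases hab : a = b'
      · exact Or.inl hab
      right
      have haA : a ∈ A := by
        have := M.fundCircuit_subset_insert _ _ ha
        simpa [hab] using this
      have hedge : Exchangeable M A b' a := by
        have := (hA.mem_fundCircuit_iff hcl (by simpa using hbA)).1 ha
        refine this.subset ?_
        intro x hx
        rcases hx with rfl | hx
        · exact ⟨Or.inl rfl, fun h => hab h.symm⟩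
        · exact ⟨Or.inr hx.1, hx.2⟩
      simp only [hF, Finset.coe_union, Set.mem_union, Finset.mem_coe]
      by_cases haB : a ∈ B
      · exact Or.inr (Finset.mem_inter.2 ⟨haA, haB⟩)
      · refine Or.inl (Finset.mem_inter.2 ⟨Finset.mem_biUnion.2 ⟨b', hb', ?_⟩, haA⟩)
        exact Finset.mem_filter.2 ⟨Finset.mem_symmDiff.2 (Or.inl ⟨haA, haB⟩), hedge⟩
  obtain ⟨g, hg, hgt⟩ := (Finset.all_card_le_biUnion_card_iff_exists_injective t).1 hall
  have hgY : ∀ b : Y, g b ∈ Y := fun b => (Finset.mem_filter.1 (hgt b)).1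
  let f : Y → Y := fun b => ⟨g b, hgY b⟩
  have hf : Function.Injective f := fun x y h => hg (congrArg Subtype.val h)
  refine ⟨Equiv.ofBijective f (Finite.injective_iff_bijective.1 hf), fun b => ?_⟩
  exact (Finset.mem_filter.1 (hgt b)).2

/-- Simultaneous exchange of matched pairs `(b i, a i)`. If all exchangeable pairs that are not
matched increase a potential `P`, the matching is the only perfect one on each of its parts, and
all pairs may be exchanged at once. -/
lemma indep_exchange_of_potential {V ι : Type*} [DecidableEq V] {M : Matroid V} {A : Finset V}
    (hE : M.E = Set.univ) (hA : M.Indep (A : Set V)) (T : Finset ι) (b a : ι → V)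
    (hba : ∀ i ∈ T, Exchangeable M A (b i) (a i))
    (hinj : ∀ i ∈ T, ∀ j ∈ T, a i = a j → b i = b j) (P : V → ℝ)
    (hP : ∀ i ∈ T, ∀ j ∈ T, Exchangeable M A (b i) (a j) → a j ≠ a i → P (a i) < P (a j)) :
    M.Indep (((A \ T.image a) ∪ (T.image b \ A) : Finset V) : Set V) := by
  classical
  rw [Matroid.indep_iff_forall_subset_not_isCircuit (by simp [hE])]
  intro C hC hCirc
  set T' : Finset ι := T.filter fun i => b i ∈ C ∧ b i ∉ A with hT'
  have hne : T'.Nonempty := by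
    by_contra hemp
    rw [Finset.not_nonempty_iff_eq_empty] at hemp
    refine hCirc.not_indep (hA.subset ?_)
    intro x hx
    have := hC hx
    simp only [Finset.coe_union, Finset.coe_sdiff, Set.mem_union, Set.mem_sdiff,
      Finset.mem_coe, Finset.mem_image] at this
    rcases this with h | ⟨⟨i, hi, rfl⟩, h⟩
    · exact h.1
    · have : i ∈ T' := Finset.mem_filter.2 ⟨hi, hx, h⟩
      simp [hemp] at this
  obtain ⟨i, hi, hmin⟩ := T'.exists_min_image (fun i => P (a i)) hne
  obtain ⟨hiT, hiC, hiA⟩ := Finset.mem_filter.1 hi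
  have hAi : M.Indep ((A : Set V) \ {a i}) := hA.subset Set.sdiff_subset
  have hsub : C \ {b i} ⊆ M.closure ((A : Set V) \ {a i}) := by
    rintro x ⟨hx, hxi⟩
    have := hC hx
    simp only [Finset.coe_union, Finset.coe_sdiff, Set.mem_union, Set.mem_sdiff,
      Finset.mem_coe, Finset.mem_image] at this
    rcases this with h | ⟨⟨j, hj, rfl⟩, h⟩
    · refine M.mem_closure_of_mem ⟨h.1, ?_⟩ (by simp [hE])
      rintro rfl
      exact h.2 ⟨i, hiT, rfl⟩
    · by_contra hcl
      have hedge : Exchangeable M A (b j) (a i) :=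
        ((hAi.notMem_closure_iff (by simp [hE])).1 hcl).1
      have hne : a i ≠ a j := fun h' => hxi (hinj j hj i hiT h'.symm)
      have h1 := hP j hj i hiT hedge hne
      have h2 := hmin j (Finset.mem_filter.2 ⟨hj, hx, h⟩)
      exact absurd h1 (not_lt.2 h2)
  have h1 : b i ∈ M.closure ((A : Set V) \ {a i}) := by
    have h2 := hCirc.mem_closure_sdiff_singleton_of_mem hiC
    exact M.closure_subset_closure_of_subset_closure hsub h2
  exact ((hAi.notMem_closure_iff (by simp [hE])).2 ⟨hba i hiT, fun h => hiA h.1⟩) h1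

/-! ### Exchange cycles of extremal density -/

/-- A cycle of length `ℓ` alternating between the relations `E₂` and `E₁`, presented by two
`ℓ`-periodic sequences of vertices: `b i` is related to `a i` by `E₂` and to `a (i + 1)` by `E₁`.
No vertex is repeated within a period on either side. -/
structure IsExchangeCycle {V : Type*} (E₁ E₂ : V → V → Prop) (Y : Finset V) (ℓ : ℕ)
    (b a : ℕ → V) : Prop where
  pos : 0 < ℓ
  periodic_b : ∀ i, b (i + ℓ) = b i
  periodic_a : ∀ i, a (i + ℓ) = a i
  inj_b : ∀ i < ℓ, ∀ j < ℓ, b i = b j → i = j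
  inj_a : ∀ i < ℓ, ∀ j < ℓ, a i = a j → i = j
  mem_b : ∀ i, b i ∈ Y
  mem_a : ∀ i, a i ∈ Y
  edge₁ : ∀ i, E₁ (b i) (a (i + 1))
  edge₂ : ∀ i, E₂ (b i) (a i)

/-- The weight of a cycle, where its `b`-vertices count positively and its `a`-vertices
negatively. -/
def cycleWeight {V : Type*} (wb wa : V → ℝ) (ℓ : ℕ) (b a : ℕ → V) : ℝ :=
  ∑ i ∈ Finset.range ℓ, (wb (b i) - wa (a i))

/-- A cycle has at least the density (weight per length) of every other cycle, and more than that
of every shorter one. -/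
structure IsExtremalCycle {V : Type*} (E₁ E₂ : V → V → Prop) (Y : Finset V) (wb wa : V → ℝ) (ℓ : ℕ)
    (b a : ℕ → V) : Prop extends IsExchangeCycle E₁ E₂ Y ℓ b a where
  density_le : ∀ ℓ' b' a', IsExchangeCycle E₁ E₂ Y ℓ' b' a' →
    ℓ * cycleWeight wb wa ℓ' b' a' ≤ ℓ' * cycleWeight wb wa ℓ b a
  density_lt : ∀ ℓ' b' a', IsExchangeCycle E₁ E₂ Y ℓ' b' a' → ℓ' < ℓ →
    ℓ * cycleWeight wb wa ℓ' b' a' < ℓ' * cycleWeight wb wa ℓ b a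

section Periodic

variable {f : ℕ → ℝ} {ℓ : ℕ}

lemma sum_range_shift_of_periodic (hf : ∀ i, f (i + ℓ) = f i) (k : ℕ) :
    ∑ i ∈ Finset.range ℓ, f (i + k) = ∑ i ∈ Finset.range ℓ, f i := by
  induction k with
  | zero => simp
  | succ k ih =>
    have h1 := Finset.sum_range_succ (fun i => f (i + k)) ℓ
    have h2 := Finset.sum_range_succ' (fun i => f (i + k)) ℓ
    have h3 : f (ℓ + k) = f (0 + k) := by rw [add_comm ℓ k, hf, zero_add]
    have h4 : ∑ i ∈ Finset.range ℓ, f (i + (k + 1)) = ∑ i ∈ Finset.range ℓ, f (i + 1 + k) :=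
      Finset.sum_congr rfl fun i _ => by rw [add_right_comm, add_assoc]
    rw [h4]
    linarith

lemma sum_range_mul_of_periodic (hf : ∀ i, f (i + ℓ) = f i) (k : ℕ) :
    ∑ i ∈ Finset.range (k * ℓ), f i = k * ∑ i ∈ Finset.range ℓ, f i := by
  induction k with
  | zero => simp
  | succ k ih =>
    rw [add_mul, one_mul, add_comm, Finset.sum_range_add]
    have : ∑ x ∈ Finset.range (k * ℓ), f (ℓ + x) = ∑ x ∈ Finset.range (k * ℓ), f x :=
      Finset.sum_congr rfl fun i _ => by rw [add_comm, hf]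
    rw [this, ih]
    push_cast
    ring

end Periodic

namespace IsExchangeCycle

variable {V : Type*} {E₁ E₂ : V → V → Prop} {Y : Finset V} {ℓ : ℕ} {b a : ℕ → V}

lemma b_mod (h : IsExchangeCycle E₁ E₂ Y ℓ b a) (i : ℕ) : b (i % ℓ) = b i :=
  Function.Periodic.map_mod_nat (a := ℓ) h.periodic_b i

lemma a_mod (h : IsExchangeCycle E₁ E₂ Y ℓ b a) (i : ℕ) : a (i % ℓ) = a i :=
  Function.Periodic.map_mod_nat (a := ℓ) h.periodic_a i

lemma a_eq_iff (h : IsExchangeCycle E₁ E₂ Y ℓ b a) {i j : ℕ} : a i = a j ↔ i % ℓ = j % ℓ := by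
  constructor
  · intro hij
    rw [← h.a_mod i, ← h.a_mod j] at hij
    exact h.inj_a _ (Nat.mod_lt _ h.pos) _ (Nat.mod_lt _ h.pos) hij
  · intro hij
    rw [← h.a_mod i, hij, h.a_mod]

lemma b_eq_iff (h : IsExchangeCycle E₁ E₂ Y ℓ b a) {i j : ℕ} : b i = b j ↔ i % ℓ = j % ℓ := by
  constructor
  · intro hij
    rw [← h.b_mod i, ← h.b_mod j] at hij
    exact h.inj_b _ (Nat.mod_lt _ h.pos) _ (Nat.mod_lt _ h.pos) hij
  · intro hij
    rw [← h.b_mod i, hij, h.b_mod]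

/-- Traversing a cycle backwards exchanges the roles of the two relations. -/
lemma reverse (h : IsExchangeCycle E₁ E₂ Y ℓ b a) :
    IsExchangeCycle E₂ E₁ Y ℓ (fun i => b (ℓ - 1 - i % ℓ)) (fun i => a (ℓ - i % ℓ)) := by
  have hpos := h.pos
  refine ⟨hpos, fun i => by simp, fun i => by simp, ?_, ?_, fun i => h.mem_b _,
    fun i => h.mem_a _, ?_, ?_⟩
  · intro i hi j hj hij
    have := h.inj_b _ (by omega) _ (by omega) hij
    rw [Nat.mod_eq_of_lt hi, Nat.mod_eq_of_lt hj] at this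
    omega
  · intro i hi j hj hij
    simp only [Nat.mod_eq_of_lt hi, Nat.mod_eq_of_lt hj] at hij
    have e1 : ℓ - i = ℓ - i - 1 + 1 := by omega
    have e2 : ℓ - j = ℓ - j - 1 + 1 := by omega
    rw [h.a_eq_iff] at hij
    rcases Nat.eq_zero_or_pos i with rfl | hi0 <;> rcases Nat.eq_zero_or_pos j with rfl | hj0
    · rfl
    · rw [Nat.sub_zero, Nat.mod_self, Nat.mod_eq_of_lt (by omega)] at hij
      omega
    · rw [Nat.sub_zero, Nat.mod_self, Nat.mod_eq_of_lt (by omega)] at hij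
      omega
    · rw [Nat.mod_eq_of_lt (by omega), Nat.mod_eq_of_lt (by omega)] at hij
      omega
  · intro i
    have hlt := Nat.mod_lt i hpos
    have key : a (ℓ - (i + 1) % ℓ) = a (ℓ - 1 - i % ℓ) := by
      rw [Nat.add_mod]
      rcases Nat.lt_or_ge (i % ℓ + 1) ℓ with h1 | h1
      · have : (i % ℓ + 1 % ℓ) % ℓ = i % ℓ + 1 := by
          rw [Nat.add_mod_mod, Nat.mod_eq_of_lt h1]
        rw [this]
        congr 1
        omega
      · have h2 : i % ℓ + 1 = ℓ := by omega
        have : (i % ℓ + 1 % ℓ) % ℓ = 0 := by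
          rw [Nat.add_mod_mod, h2, Nat.mod_self]
        rw [this]
        have h3 : ℓ - 1 - i % ℓ = 0 := by omega
        rw [h3, h.a_eq_iff]
        simp
    show E₂ (b (ℓ - 1 - i % ℓ)) (a (ℓ - (i + 1) % ℓ))
    rw [key]
    exact h.edge₂ _
  · intro i
    have hlt := Nat.mod_lt i hpos
    have := h.edge₁ (ℓ - 1 - i % ℓ)
    rwa [show ℓ - 1 - i % ℓ + 1 = ℓ - i % ℓ by omega] at this

lemma cycleWeight_reverse (h : IsExchangeCycle E₁ E₂ Y ℓ b a) (wb wa : V → ℝ) :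
    cycleWeight wb wa ℓ (fun i => b (ℓ - 1 - i % ℓ)) (fun i => a (ℓ - i % ℓ)) =
      cycleWeight wb wa ℓ b a := by
  have e1 : ∑ i ∈ Finset.range ℓ, wb (b (ℓ - 1 - i % ℓ)) = ∑ i ∈ Finset.range ℓ, wb (b i) := by
    rw [← Finset.sum_range_reflect]
    refine Finset.sum_congr rfl fun i hi => ?_
    have hi := Finset.mem_range.1 hi
    rw [Nat.mod_eq_of_lt (by omega)]
    congr 2
    omega
  have e2 : ∑ i ∈ Finset.range ℓ, wa (a (ℓ - i % ℓ)) = ∑ i ∈ Finset.range ℓ, wa (a i) := by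
    rw [← sum_range_shift_of_periodic (f := fun i => wa (a i))
      (fun i => by simp only [h.periodic_a]) 1, ← Finset.sum_range_reflect]
    refine Finset.sum_congr rfl fun i hi => ?_
    have hi := Finset.mem_range.1 hi
    rw [Nat.mod_eq_of_lt (by omega)]
    congr 2
    omega
  simp only [cycleWeight, Finset.sum_sub_distrib, e1, e2]

/-- An `E₁`-edge from `b (y + k)` back to `a y` closes the segment from `y` to `y + k` to a
cycle. -/
lemma shortcut (h : IsExchangeCycle E₁ E₂ Y ℓ b a) {y k : ℕ} (hk : k < ℓ)
    (he : E₁ (b (y + k)) (a y)) :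
    IsExchangeCycle E₁ E₂ Y (k + 1) (fun i => b (y + i % (k + 1)))
      (fun i => a (y + i % (k + 1))) := by
  have hmod : ∀ {i j : ℕ}, i < k + 1 → j < k + 1 → (y + i) % ℓ = (y + j) % ℓ → i = j := by
    intro i j hi hj hij
    have h1 : i ≡ j [MOD ℓ] := Nat.ModEq.add_left_cancel' y hij
    have := Nat.ModEq.eq_of_lt_of_lt h1 (by omega) (by omega)
    exact this
  refine ⟨Nat.succ_pos k, fun i => by simp, fun i => by simp, ?_, ?_, fun i => h.mem_b _,
    fun i => h.mem_a _, ?_, fun i => h.edge₂ _⟩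
  · intro i hi j hj hij
    simp only [Nat.mod_eq_of_lt hi, Nat.mod_eq_of_lt hj, h.b_eq_iff] at hij
    exact hmod hi hj hij
  · intro i hi j hj hij
    simp only [Nat.mod_eq_of_lt hi, Nat.mod_eq_of_lt hj, h.a_eq_iff] at hij
    exact hmod hi hj hij
  · intro i
    have hlt : i % (k + 1) < k + 1 := Nat.mod_lt i (Nat.succ_pos k)
    have hadd : (i + 1) % (k + 1) = (i % (k + 1) + 1) % (k + 1) := by simp
    show E₁ (b (y + i % (k + 1))) (a (y + (i + 1) % (k + 1)))
    rcases Nat.lt_or_ge (i % (k + 1)) k with h1 | h1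
    · rw [hadd, Nat.mod_eq_of_lt (show i % (k + 1) + 1 < k + 1 by omega)]
      exact h.edge₁ _
    · have h2 : i % (k + 1) = k := by omega
      rw [hadd, h2, Nat.mod_self]
      exact he

end IsExchangeCycle

/-- There are finitely many cycles up to their vertex sets, so one of them is extremal. -/
lemma IsExchangeCycle.exists_extremal {V : Type*} [Finite V] {E₁ E₂ : V → V → Prop}
    {Y : Finset V} {ℓ₀ : ℕ} {b₀ a₀ : ℕ → V} (h₀ : IsExchangeCycle E₁ E₂ Y ℓ₀ b₀ a₀)
    (wb wa : V → ℝ) : ∃ ℓ b a, IsExtremalCycle E₁ E₂ Y wb wa ℓ b a := by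
  classical
  set s : Set (Finset V × Finset V) := {q | ∃ ℓ b a, IsExchangeCycle E₁ E₂ Y ℓ b a ∧
    q = ((Finset.range ℓ).image b, (Finset.range ℓ).image a)} with hs
  set W : Finset V × Finset V → ℝ := fun q => ∑ x ∈ q.1, wb x - ∑ x ∈ q.2, wa x with hW
  have hcard : ∀ {ℓ b a}, IsExchangeCycle E₁ E₂ Y ℓ b a → ((Finset.range ℓ).image b).card = ℓ := by
    intro ℓ b a h
    rw [Finset.card_image_of_injOn, Finset.card_range]
    intro i hi j hj
    exact h.inj_b i (by simpa using hi) j (by simpa using hj)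
  have hWeq : ∀ {ℓ b a}, IsExchangeCycle E₁ E₂ Y ℓ b a →
      W ((Finset.range ℓ).image b, (Finset.range ℓ).image a) = cycleWeight wb wa ℓ b a := by
    intro ℓ b a h
    simp only [hW, cycleWeight, Finset.sum_sub_distrib]
    rw [Finset.sum_image fun i hi j hj => h.inj_b i (by simpa using hi) j (by simpa using hj),
      Finset.sum_image fun i hi j hj => h.inj_a i (by simpa using hi) j (by simpa using hj)]
  obtain ⟨q, hq, hmax⟩ := Set.exists_max_image s (fun q => W q / q.1.card) (Set.toFinite s)
    ⟨_, ℓ₀, b₀, a₀, h₀, rfl⟩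
  obtain ⟨r, ⟨hr, hrq⟩, hmin⟩ := Set.exists_min_image
    {r | r ∈ s ∧ W r / r.1.card = W q / q.1.card} (fun r => r.1.card) (Set.toFinite _) ⟨q, hq, rfl⟩
  obtain ⟨ℓ, b, a, h, rfl⟩ := hr
  have hdens : ∀ ℓ' b' a', IsExchangeCycle E₁ E₂ Y ℓ' b' a' →
      cycleWeight wb wa ℓ' b' a' / ℓ' ≤ cycleWeight wb wa ℓ b a / ℓ := by
    intro ℓ' b' a' h'
    have h1 := hmax _ ⟨ℓ', b', a', h', rfl⟩
    simp only at h1 hrq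
    rw [← hrq, hcard h, hcard h', hWeq h, hWeq h'] at h1
    exact h1
  have hpos : (0 : ℝ) < ℓ := Nat.cast_pos.2 h.pos
  refine ⟨ℓ, b, a, h, ?_, ?_⟩
  · intro ℓ' b' a' h'
    have h1 := hdens _ _ _ h'
    rw [div_le_div_iff₀ (Nat.cast_pos.2 h'.pos) hpos] at h1
    linarith
  · intro ℓ' b' a' h' hlt
    have h1 : cycleWeight wb wa ℓ' b' a' / ℓ' < cycleWeight wb wa ℓ b a / ℓ := by
      refine lt_of_le_of_ne (hdens _ _ _ h') fun heq => ?_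
      have h2 := hmin ((Finset.range ℓ').image b', (Finset.range ℓ').image a')
        ⟨⟨ℓ', b', a', h', rfl⟩, ?_⟩
      · simp only [hcard h, hcard h'] at h2
        omega
      · simp only at hrq ⊢
        rw [← hrq, hcard h, hcard h', hWeq h, hWeq h', heq]
    rw [div_lt_div_iff₀ (Nat.cast_pos.2 h'.pos) hpos] at h1
    linarith

namespace IsExtremalCycle

variable {V : Type*} {E₁ E₂ : V → V → Prop} {Y : Finset V} {ℓ : ℕ} {b a : ℕ → V} {wb wa : V → ℝ}

lemma reverse (h : IsExtremalCycle E₁ E₂ Y wb wa ℓ b a) :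
    IsExtremalCycle E₂ E₁ Y wb wa ℓ (fun i => b (ℓ - 1 - i % ℓ)) (fun i => a (ℓ - i % ℓ)) where
  toIsExchangeCycle := h.toIsExchangeCycle.reverse
  density_le ℓ' b' a' h' := by
    rw [h.toIsExchangeCycle.cycleWeight_reverse, ← h'.cycleWeight_reverse]
    exact h.density_le _ _ _ h'.reverse
  density_lt ℓ' b' a' h' := by
    rw [h.toIsExchangeCycle.cycleWeight_reverse, ← h'.cycleWeight_reverse]
    exact h.density_lt _ _ _ h'.reverse

/-- The prefix sums of the weight in excess of the density are well defined on the vertices of a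
cycle. On an extremal cycle they increase along every `E₁`-edge which is not an edge of the cycle,
because that edge is a shortcut to a shorter cycle, whose density is smaller. -/
lemma exists_potential (h : IsExtremalCycle E₁ E₂ Y wb wa ℓ b a) :
    ∃ P : V → ℝ, ∀ x y, E₁ (b x) (a y) → a y ≠ a (x + 1) → P (a (x + 1)) < P (a y) := by
  classical
  have hc := h.toIsExchangeCycle
  have hpos : (0 : ℝ) < ℓ := Nat.cast_pos.2 h.pos
  set w : ℕ → ℝ := fun i => wb (b i) - wa (a i) - cycleWeight wb wa ℓ b a / ℓ with hw
  have hwper : ∀ i, w (i + ℓ) = w i := fun i => by simp only [hw, h.periodic_a, h.periodic_b]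
  set G : ℕ → ℝ := fun i => ∑ j ∈ Finset.range i, w j with hG
  have hwsum : ∑ j ∈ Finset.range ℓ, w j = 0 := by
    simp only [hw]
    rw [Finset.sum_sub_distrib, Finset.sum_const, Finset.card_range, nsmul_eq_mul,
      mul_div_cancel₀ _ hpos.ne']
    exact sub_self _
  have hGper : ∀ i, G (i + ℓ) = G i := by
    intro i
    simp only [hG]
    rw [add_comm, Finset.sum_range_add, hwsum, zero_add]
    exact Finset.sum_congr rfl fun j _ => by rw [add_comm, hwper]
  have hGmod : ∀ i, G (i % ℓ) = G i := Function.Periodic.map_mod_nat (a := ℓ) hGper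
  set P : V → ℝ := fun v => if hv : ∃ i, a i = v then G hv.choose else 0 with hP
  have hPG : ∀ i, P (a i) = G i := by
    intro i
    have hv : ∃ j, a j = a i := ⟨i, rfl⟩
    simp only [hP, dif_pos hv]
    rw [← hGmod, hc.a_eq_iff.1 hv.choose_spec, hGmod]
  refine ⟨P, fun x y he hne => ?_⟩
  -- Representatives with `y ≤ x < y + ℓ`.
  obtain ⟨y', k, hk, hy, hx⟩ : ∃ y' k, k < ℓ ∧ y' % ℓ = y % ℓ ∧ (y' + k) % ℓ = x % ℓ := by
    have h1 := Nat.mod_lt x h.pos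
    have h2 := Nat.mod_lt y h.pos
    rcases Nat.lt_or_ge (x % ℓ) (y % ℓ) with h3 | h3
    · refine ⟨y % ℓ, x % ℓ + ℓ - y % ℓ, by omega, Nat.mod_mod _ _, ?_⟩
      rw [show y % ℓ + (x % ℓ + ℓ - y % ℓ) = x % ℓ + ℓ by omega]
      simp
    · refine ⟨y % ℓ, x % ℓ - y % ℓ, by omega, Nat.mod_mod _ _, ?_⟩
      rw [show y % ℓ + (x % ℓ - y % ℓ) = x % ℓ by omega]
      simp
  have hay : a y = a y' := hc.a_eq_iff.2 hy.symm
  have hbx : b x = b (y' + k) := hc.b_eq_iff.2 hx.symm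
  have hax : a (x + 1) = a (y' + k + 1) := by
    rw [hc.a_eq_iff, Nat.add_mod, ← hx, ← Nat.add_mod]
  rw [hay, hbx] at he
  rw [hay, hax] at hne ⊢
  have hlt : k + 1 < ℓ := by
    refine lt_of_le_of_ne hk fun heq => hne ?_
    rw [add_assoc, heq, h.periodic_a]
  have hd := h.density_lt _ _ _ (hc.shortcut hk he) hlt
  have hsum : cycleWeight wb wa (k + 1) (fun i => b (y' + i % (k + 1)))
      (fun i => a (y' + i % (k + 1))) =
      G (y' + k + 1) - G y' + (k + 1 : ℕ) * (cycleWeight wb wa ℓ b a / ℓ) := by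
    have h1 : G (y' + k + 1) = G y' + ∑ i ∈ Finset.range (k + 1), w (y' + i) := by
      simp only [hG]
      rw [add_assoc, Finset.sum_range_add]
    rw [h1, add_sub_cancel_left]
    simp only [hw]
    rw [Finset.sum_sub_distrib, Finset.sum_const, Finset.card_range, nsmul_eq_mul,
      sub_add_cancel]
    refine Finset.sum_congr rfl fun i hi => ?_
    simp only [Nat.mod_eq_of_lt (Finset.mem_range.1 hi)]
  rw [hsum, mul_add] at hd
  have h3 : (ℓ : ℝ) * ((k + 1 : ℕ) * (cycleWeight wb wa ℓ b a / ℓ)) =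
      (k + 1 : ℕ) * cycleWeight wb wa ℓ b a := by
    field_simp
  rw [h3] at hd
  rw [hPG, hPG]
  have h4 : (ℓ : ℝ) * (G (y' + k + 1) - G y') < 0 := by linarith
  by_contra hcon
  have : 0 ≤ (ℓ : ℝ) * (G (y' + k + 1) - G y') := mul_nonneg hpos.le (by linarith)
  linarith

end IsExtremalCycle

/-- The second matching of an extremal cycle has a potential as well. -/
lemma IsExtremalCycle.exists_potential₂ {V : Type*} {E₁ E₂ : V → V → Prop} {Y : Finset V} {ℓ : ℕ}
    {b a : ℕ → V} {wb wa : V → ℝ} (h : IsExtremalCycle E₁ E₂ Y wb wa ℓ b a) :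
    ∃ P : V → ℝ, ∀ x y, E₂ (b x) (a y) → a y ≠ a x → P (a x) < P (a y) := by
  obtain ⟨P, hP⟩ := h.reverse.exists_potential
  have ha : ∀ j, a (ℓ - (ℓ - j % ℓ) % ℓ) = a j := by
    intro j
    have hj := Nat.mod_lt j h.pos
    rcases Nat.eq_zero_or_pos (j % ℓ) with h0 | h0
    · rw [h0, h.toIsExchangeCycle.a_eq_iff]
      simp [h0]
    · rw [Nat.mod_eq_of_lt (show ℓ - j % ℓ < ℓ by omega), Nat.sub_sub_self hj.le,
        h.toIsExchangeCycle.a_mod]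
  refine ⟨P, fun x y he hne => ?_⟩
  have hx := Nat.mod_lt x h.pos
  have := hP (ℓ - 1 - x % ℓ) (ℓ - y % ℓ)
  simp only [ha] at this
  rw [Nat.mod_eq_of_lt (show ℓ - 1 - x % ℓ < ℓ by omega), Nat.sub_sub_self (by omega),
    h.toIsExchangeCycle.b_mod, show ℓ - 1 - x % ℓ + 1 = ℓ - x % ℓ by omega, ha] at this
  exact this he hne

/-- Two perfect matchings, one in each relation, decompose into cycles. -/
lemma isExchangeCycle_of_perm {V : Type*} {E₁ E₂ : V → V → Prop} {Y : Finset V}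
    (f₁ f₂ : Equiv.Perm Y) (h₁ : ∀ y : Y, E₁ y (f₁ y)) (h₂ : ∀ y : Y, E₂ y (f₂ y)) (y : Y) :
    IsExchangeCycle E₁ E₂ Y (Function.minimalPeriod (f₁.trans f₂.symm) y)
      (fun i => ((f₁.trans f₂.symm)^[i] y : Y)) (fun i => f₂ ((f₁.trans f₂.symm)^[i] y)) := by
  set σ : Equiv.Perm Y := f₁.trans f₂.symm with hσ
  have hper : ∀ i, σ^[i + Function.minimalPeriod σ y] y = σ^[i] y := by
    intro i
    simp
  have hinj : ∀ i < Function.minimalPeriod σ y, ∀ j < Function.minimalPeriod σ y,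
      σ^[i] y = σ^[j] y → i = j := fun i hi j hj hij =>
    (Function.iterate_eq_iterate_iff_of_lt_minimalPeriod hi hj).1 hij
  refine ⟨Function.minimalPeriod_pos_of_mem_periodicPts (σ.injective.mem_periodicPts y),
    fun i => by simp only [hper], fun i => by simp only [hper], ?_, ?_,
    fun i => Subtype.coe_prop _, fun i => Subtype.coe_prop _, ?_, fun i => h₂ _⟩
  · exact fun i hi j hj hij => hinj i hi j hj (Subtype.ext hij)
  · exact fun i hi j hj hij => hinj i hi j hj (f₂.injective (Subtype.ext hij))
  · intro i
    have : f₂ (σ^[i + 1] y) = f₁ (σ^[i] y) := by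
      rw [Function.iterate_succ_apply']
      simp [hσ]
    simp only [this]
    exact h₁ _

/-- An extremal cycle has at least the density of the whole vertex set. -/
lemma IsExtremalCycle.le_density {V : Type*} {E₁ E₂ : V → V → Prop} {Y : Finset V} {ℓ : ℕ}
    {b a : ℕ → V} {wb wa : V → ℝ} (h : IsExtremalCycle E₁ E₂ Y wb wa ℓ b a)
    (f₁ f₂ : Equiv.Perm Y) (h₁ : ∀ y : Y, E₁ y (f₁ y)) (h₂ : ∀ y : Y, E₂ y (f₂ y)) :
    ℓ * (∑ y ∈ Y, wb y - ∑ y ∈ Y, wa y) ≤ Y.card * cycleWeight wb wa ℓ b a := by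
  set σ : Equiv.Perm Y := f₁.trans f₂.symm with hσ
  set w : Y → ℝ := fun y => wb y - wa (f₂ y) with hw
  set N := orderOf σ with hN
  have hNpos : 0 < N := orderOf_pos σ
  have hy : ∀ y : Y, ℓ * ∑ i ∈ Finset.range N, w (σ^[i] y) ≤ N * cycleWeight wb wa ℓ b a := by
    intro y
    have hc := isExchangeCycle_of_perm f₁ f₂ h₁ h₂ y
    rw [← hσ] at hc
    obtain ⟨k, hk⟩ : Function.minimalPeriod σ y ∣ N := by
      refine Function.IsPeriodicPt.minimalPeriod_dvd ?_
      show σ^[N] y = y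
      rw [← Equiv.Perm.coe_pow, hN, pow_orderOf_eq_one]
      rfl
    have h3 := h.density_le _ _ _ hc
    have h4 : ∑ i ∈ Finset.range N, w (σ^[i] y) =
        k * ∑ i ∈ Finset.range (Function.minimalPeriod σ y), w (σ^[i] y) := by
      rw [hk, mul_comm]
      exact sum_range_mul_of_periodic (fun i => by simp) k
    rw [h4, hk]
    calc (ℓ : ℝ) * (k * ∑ i ∈ Finset.range (Function.minimalPeriod σ y), w (σ^[i] y))
        = k * (ℓ * ∑ i ∈ Finset.range (Function.minimalPeriod σ y), w (σ^[i] y)) := by ring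
      _ ≤ k * (Function.minimalPeriod σ y * cycleWeight wb wa ℓ b a) :=
          mul_le_mul_of_nonneg_left h3 (Nat.cast_nonneg k)
      _ = _ := by push_cast; ring
  have hsum : ∑ y : Y, ∑ i ∈ Finset.range N, w (σ^[i] y) =
      N * (∑ y ∈ Y, wb y - ∑ y ∈ Y, wa y) := by
    rw [Finset.sum_comm]
    have : ∀ i, ∑ y : Y, w (σ^[i] y) = ∑ y ∈ Y, wb y - ∑ y ∈ Y, wa y := by
      intro i
      have h5 : ∑ y : Y, w (σ^[i] y) = ∑ y : Y, w y := by
        rw [← Equiv.sum_comp (σ ^ i) w]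
        rfl
      rw [h5]
      simp only [hw, Finset.sum_sub_distrib]
      rw [Equiv.sum_comp f₂ fun y : Y => wa y, Finset.sum_coe_sort Y wb, Finset.sum_coe_sort Y wa]
    rw [Finset.sum_congr rfl fun i _ => this i, Finset.sum_const, Finset.card_range, nsmul_eq_mul]
  have htot : (ℓ : ℝ) * (N * (∑ y ∈ Y, wb y - ∑ y ∈ Y, wa y)) ≤
      Y.card * (N * cycleWeight wb wa ℓ b a) := by
    rw [← hsum, Finset.mul_sum]
    refine (Finset.sum_le_sum fun y _ => hy y).trans ?_
    simp
  have hN' : (0 : ℝ) < N := Nat.cast_pos.2 hNpos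
  refine le_of_mul_le_mul_left ?_ hN'
  linarith

/-! ### Bounded exchanges for two matroids -/

/-- Any part of an extremal cycle may be exchanged, provided that with each added vertex both of its
neighbours on the cycle are removed. -/
lemma IsExtremalCycle.commonIndep_exchange {V : Type*} [DecidableEq V] {M₁ M₂ : Matroid V}
    {A : Finset V} (hE₁ : M₁.E = Set.univ) (hE₂ : M₂.E = Set.univ) (hA : CommonIndep M₁ M₂ A)
    {Y : Finset V} {ℓ : ℕ} {b a : ℕ → V} {wb wa : V → ℝ}
    (h : IsExtremalCycle (Exchangeable M₁ A) (Exchangeable M₂ A) Y wb wa ℓ b a)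
    (T : Finset ℕ) (R : Finset V) (hR : ∀ i ∈ T, a i ∈ R ∧ a (i + 1) ∈ R) :
    CommonIndep M₁ M₂ ((A \ R) ∪ (T.image b \ A)) := by
  have hc := h.toIsExchangeCycle
  constructor
  · obtain ⟨P, hP⟩ := h.exists_potential
    refine (indep_exchange_of_potential hE₁ hA.1 T b (fun i => a (i + 1)) (fun i _ => hc.edge₁ i)
      ?_ P (fun i _ j _ => hP i (j + 1))).subset ?_
    · intro i _ j _ hij
      rw [hc.a_eq_iff] at hij
      exact hc.b_eq_iff.2 (Nat.ModEq.add_right_cancel' 1 hij)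
    · refine Finset.coe_subset.2 (Finset.union_subset_union_left
        (Finset.sdiff_subset_sdiff le_rfl ?_))
      intro x hx
      obtain ⟨i, hi, rfl⟩ := Finset.mem_image.1 hx
      exact (hR i hi).2
  · obtain ⟨P, hP⟩ := h.exists_potential₂
    refine (indep_exchange_of_potential hE₂ hA.2 T b a (fun i _ => hc.edge₂ i)
      ?_ P (fun i _ j _ => hP i j)).subset ?_
    · intro i _ j _ hij
      rw [hc.a_eq_iff] at hij
      exact hc.b_eq_iff.2 hij
    · refine Finset.coe_subset.2 (Finset.union_subset_union_left
        (Finset.sdiff_subset_sdiff le_rfl ?_))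
      intro x hx
      obtain ⟨i, hi, rfl⟩ := Finset.mem_image.1 hx
      exact (hR i hi).1

lemma sum_image_sdiff {V : Type*} [DecidableEq V] (T : Finset ℕ) (f : ℕ → V) (A : Finset V)
    (hf : Set.InjOn f T) (u : V → ℝ) :
    ∑ x ∈ T.image f \ A, u x = ∑ i ∈ T, if f i ∈ A then 0 else u (f i) := by
  rw [Finset.sdiff_eq_filter, Finset.sum_filter, Finset.sum_image hf]
  exact Finset.sum_congr rfl fun i _ => by simp only [ite_not]

lemma sum_image_inter {V : Type*} [DecidableEq V] (T : Finset ℕ) (f : ℕ → V) (A : Finset V)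
    (hf : Set.InjOn f T) (u : V → ℝ) :
    ∑ x ∈ T.image f ∩ A, u x = ∑ i ∈ T, if f i ∈ A then u (f i) else 0 := by
  rw [← Finset.filter_mem_eq_inter, Finset.sum_filter, Finset.sum_image hf]

/-- Local search is nearly optimal for linear objectives on the intersection of two matroids: an
exchange that adds at most `p` elements and removes at most `p + 1` makes up for a fraction of the
gap between `A` and `B`. It is an extremal cycle, or the best of the segments of such a cycle with
`p` added elements; a segment has one more removed element than added ones, whence the factor
`1 + 1 / p`. -/
theorem exists_bounded_exchange {V : Type*} [Fintype V] [DecidableEq V] {M₁ M₂ : Matroid V}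
    (hE₁ : M₁.E = Set.univ) (hE₂ : M₂.E = Set.univ) {A B : Finset V} (hA : CommonIndep M₁ M₂ A)
    (hB : CommonIndep M₁ M₂ B) (u v : V → ℝ) (hv : ∀ x, 0 ≤ v x) {p : ℕ} (hp : 0 < p) :
    ∃ R S : Finset V, R ⊆ A ∧ Disjoint S A ∧ S.card ≤ p ∧ R.card ≤ p + 1 ∧
      CommonIndep M₁ M₂ ((A \ R) ∪ S) ∧
      ∑ x ∈ B \ A, u x - (1 + 1 / (p : ℝ)) * ∑ x ∈ A \ B, v x ≤
        Fintype.card V * (∑ x ∈ S, u x - ∑ x ∈ R, v x) := by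
  set L : ℝ := ∑ x ∈ B \ A, u x - (1 + 1 / (p : ℝ)) * ∑ x ∈ A \ B, v x with hL
  have hp' : (0 : ℝ) < p := Nat.cast_pos.2 hp
  rcases le_or_gt L 0 with hL0 | hL0
  · exact ⟨∅, ∅, by simp, by simp, by simp, by simp, by simpa using hA, by simpa using hL0⟩
  set Y : Finset V := symmDiff A B with hY
  set wb : V → ℝ := fun x => if x ∈ A then 0 else u x with hwb
  set va : V → ℝ := fun x => if x ∈ A then v x else 0 with hva
  set wa : V → ℝ := fun x => (1 + 1 / (p : ℝ)) * va x with hwa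
  have hva0 : ∀ x, 0 ≤ va x := fun x => by
    simp only [hva]
    split_ifs
    exacts [hv x, le_rfl]
  obtain ⟨f₁, h₁⟩ := exists_perm_exchangeable hE₁ hA.1 hB.1
  obtain ⟨f₂, h₂⟩ := exists_perm_exchangeable hE₂ hA.2 hB.2
  have hYne : Y.Nonempty := by
    by_contra hemp
    rw [Finset.not_nonempty_iff_eq_empty, hY, ← Finset.bot_eq_empty, symmDiff_eq_bot] at hemp
    subst hemp
    simp [hL] at hL0
  obtain ⟨y, hy⟩ := hYne
  obtain ⟨ℓ, b, a, h⟩ := (isExchangeCycle_of_perm f₁ f₂ h₁ h₂ ⟨y, hy⟩).exists_extremal wb wa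
  have hc := h.toIsExchangeCycle
  have hdens := h.le_density f₁ f₂ h₁ h₂
  have hLY : ∑ y ∈ Y, wb y - ∑ y ∈ Y, wa y = L := by
    have e1 : ∑ y ∈ Y, wb y = ∑ x ∈ B \ A, u x := by
      have : B \ A = Y.filter fun x => ¬ x ∈ A := by
        ext x
        simp only [hY, Finset.mem_sdiff, Finset.mem_filter, Finset.mem_symmDiff]
        tauto
      rw [this, Finset.sum_filter]
      exact Finset.sum_congr rfl fun x _ => by simp only [hwb, ite_not]
    have e2 : ∑ y ∈ Y, va y = ∑ x ∈ A \ B, v x := by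
      have : A \ B = Y.filter fun x => x ∈ A := by
        ext x
        simp only [hY, Finset.mem_sdiff, Finset.mem_filter, Finset.mem_symmDiff]
        tauto
      rw [this, Finset.sum_filter]
    rw [e1, hL]
    simp only [hwa]
    rw [← Finset.mul_sum, e2]
  rw [hLY] at hdens
  set W := cycleWeight wb wa ℓ b a with hW
  have hℓ : (0 : ℝ) < ℓ := Nat.cast_pos.2 h.pos
  have hℓ1 : (1 : ℝ) ≤ ℓ := Nat.one_le_cast.2 h.pos
  have hYV : (Y.card : ℝ) ≤ Fintype.card V := Nat.cast_le.2 (Finset.card_le_univ Y)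
  have hW0 : 0 ≤ W := by
    by_contra hneg
    have h1 : (Y.card : ℝ) * W ≤ 0 :=
      mul_nonpos_of_nonneg_of_nonpos (Nat.cast_nonneg _) (not_le.1 hneg).le
    have h2 : 0 < ℓ * L := mul_pos hℓ hL0
    linarith
  have hdens' : ℓ * L ≤ Fintype.card V * W :=
    hdens.trans (mul_le_mul_of_nonneg_right hYV hW0)
  have hsdiff : ∀ R : Finset V, A \ (R ∩ A) = A \ R := fun R => by
    rw [Finset.inter_comm, Finset.sdiff_inter_self_left]
  have hinjb : ∀ s k, k ≤ ℓ → Set.InjOn b (Finset.Ico s (s + k)) := by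
    intro s k hk i hi j hj hij
    simp only [Finset.coe_Ico, Set.mem_Ico] at hi hj
    have h1 := hc.b_eq_iff.1 hij
    have h2 : s + (i - s) ≡ s + (j - s) [MOD ℓ] := by
      rw [Nat.add_sub_cancel' hi.1, Nat.add_sub_cancel' hj.1]
      exact h1
    have h3 := Nat.ModEq.eq_of_lt_of_lt (Nat.ModEq.add_left_cancel' s h2) (by omega) (by omega)
    omega
  have hinja : ∀ s k, k ≤ ℓ → Set.InjOn a (Finset.Ico s (s + k)) := by
    intro s k hk i hi j hj hij
    simp only [Finset.coe_Ico, Set.mem_Ico] at hi hj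
    have h1 := hc.a_eq_iff.1 hij
    have h2 : s + (i - s) ≡ s + (j - s) [MOD ℓ] := by
      rw [Nat.add_sub_cancel' hi.1, Nat.add_sub_cancel' hj.1]
      exact h1
    have h3 := Nat.ModEq.eq_of_lt_of_lt (Nat.ModEq.add_left_cancel' s h2) (by omega) (by omega)
    omega
  have hWsplit : W = ∑ i ∈ Finset.range ℓ, wb (b i) -
      (1 + 1 / (p : ℝ)) * ∑ i ∈ Finset.range ℓ, va (a i) := by
    rw [hW, cycleWeight, Finset.sum_sub_distrib, Finset.mul_sum]
  rcases Nat.lt_or_ge p ℓ with hpℓ | hpℓ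
  · -- Average over all segments.
    set g : ℕ → ℝ := fun s => ∑ i ∈ Finset.range p, wb (b (s + i)) -
      ∑ i ∈ Finset.range (p + 1), va (a (s + i)) with hg
    have hgsum : ∑ s ∈ Finset.range ℓ, g s = p * W := by
      have e1 : ∑ s ∈ Finset.range ℓ, ∑ i ∈ Finset.range p, wb (b (s + i)) =
          p * ∑ i ∈ Finset.range ℓ, wb (b i) := by
        rw [Finset.sum_comm, Finset.sum_congr rfl fun k _ =>
          sum_range_shift_of_periodic (f := fun i => wb (b i))
            (fun i => by simp only [h.periodic_b]) k]
        simp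
      have e2 : ∑ s ∈ Finset.range ℓ, ∑ i ∈ Finset.range (p + 1), va (a (s + i)) =
          (p + 1) * ∑ i ∈ Finset.range ℓ, va (a i) := by
        rw [Finset.sum_comm, Finset.sum_congr rfl fun k _ =>
          sum_range_shift_of_periodic (f := fun i => va (a i))
            (fun i => by simp only [h.periodic_a]) k]
        simp
      simp only [hg]
      rw [Finset.sum_sub_distrib, e1, e2, hWsplit]
      field_simp
    obtain ⟨s, -, hs⟩ : ∃ s ∈ Finset.range ℓ, p * W / ℓ ≤ g s := by
      refine Finset.exists_le_of_sum_le ⟨0, Finset.mem_range.2 h.pos⟩ ?_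
      rw [hgsum, Finset.sum_const, Finset.card_range, nsmul_eq_mul, mul_div_cancel₀ _ hℓ.ne']
    refine ⟨(Finset.Ico s (s + (p + 1))).image a ∩ A, (Finset.Ico s (s + p)).image b \ A,
      Finset.inter_subset_right, Finset.sdiff_disjoint, ?_, ?_, ?_, ?_⟩
    · exact (Finset.card_le_card Finset.sdiff_subset).trans (Finset.card_image_le.trans (by simp))
    · exact (Finset.card_le_card Finset.inter_subset_left).trans
        (Finset.card_image_le.trans (by simp))
    · rw [hsdiff]
      refine h.commonIndep_exchange hE₁ hE₂ hA _ _ fun i hi => ?_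
      have hi := Finset.mem_Ico.1 hi
      exact ⟨Finset.mem_image_of_mem _ (Finset.mem_Ico.2 ⟨hi.1, by omega⟩),
        Finset.mem_image_of_mem _ (Finset.mem_Ico.2 ⟨by omega, by omega⟩)⟩
    · rw [sum_image_sdiff _ _ _ (hinjb s p hpℓ.le), sum_image_inter _ _ _ (hinja s (p + 1) hpℓ),
        Finset.sum_Ico_eq_sum_range, Finset.sum_Ico_eq_sum_range, Nat.add_sub_cancel_left,
        Nat.add_sub_cancel_left]
      have hs' : p * W ≤ ℓ * g s := by
        rw [div_le_iff₀ hℓ] at hs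
        linarith
      have hp1 : (1 : ℝ) ≤ p := Nat.one_le_cast.2 hp
      have h1 : ℓ * L ≤ ℓ * (Fintype.card V * g s) := by
        calc ℓ * L ≤ p * (ℓ * L) := le_mul_of_one_le_left (mul_pos hℓ hL0).le hp1
          _ ≤ p * (Fintype.card V * W) := mul_le_mul_of_nonneg_left hdens' hp'.le
          _ = Fintype.card V * (p * W) := by ring
          _ ≤ Fintype.card V * (ℓ * g s) := mul_le_mul_of_nonneg_left hs' (Nat.cast_nonneg _)
          _ = _ := by ring
      exact le_of_mul_le_mul_left h1 hℓ
  · refine ⟨(Finset.Ico 0 (0 + ℓ)).image a ∩ A, (Finset.Ico 0 (0 + ℓ)).image b \ A,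
      Finset.inter_subset_right, Finset.sdiff_disjoint, ?_, ?_, ?_, ?_⟩
    · exact (Finset.card_le_card Finset.sdiff_subset).trans
        (Finset.card_image_le.trans (by simpa using hpℓ))
    · refine (Finset.card_le_card Finset.inter_subset_left).trans
        (Finset.card_image_le.trans ?_)
      simp only [zero_add, Nat.card_Ico]
      omega
    · rw [hsdiff]
      refine h.commonIndep_exchange hE₁ hE₂ hA _ _ fun i hi => ?_
      refine ⟨Finset.mem_image_of_mem _ hi, ?_⟩
      rw [← hc.a_mod (i + 1)]
      exact Finset.mem_image_of_mem _ (by simpa using Nat.mod_lt _ h.pos)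
    · rw [sum_image_sdiff _ _ _ (hinjb 0 ℓ le_rfl), sum_image_inter _ _ _ (hinja 0 ℓ le_rfl),
        zero_add, ← Finset.range_eq_Ico]
      have hva_sum : 0 ≤ ∑ i ∈ Finset.range ℓ, va (a i) := Finset.sum_nonneg fun i _ => hva0 _
      have h1 : W ≤ ∑ i ∈ Finset.range ℓ, wb (b i) - ∑ i ∈ Finset.range ℓ, va (a i) := by
        rw [hWsplit]
        have : 0 ≤ 1 / (p : ℝ) * ∑ i ∈ Finset.range ℓ, va (a i) :=
          mul_nonneg (by positivity) hva_sum
        linarith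
      calc L ≤ ℓ * L := le_mul_of_one_le_left hL0.le hℓ1
        _ ≤ Fintype.card V * W := hdens'
        _ ≤ _ := mul_le_mul_of_nonneg_left h1 (Nat.cast_nonneg _)

/-- If `B` is more than twice as large as `A`, an element of `B` can be added to `A`, since at
most `A.card` elements of `B` are excluded by each matroid. -/
lemma exists_commonIndep_insert {V : Type*} [DecidableEq V] {M₁ M₂ : Matroid V}
    {A B : Finset V} (hA : CommonIndep M₁ M₂ A) (hB : CommonIndep M₁ M₂ B)
    (hcard : 2 * A.card < B.card) : ∃ b, b ∉ A ∧ CommonIndep M₁ M₂ (insert b A) := by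
  classical
  have key : ∀ M : Matroid V, M.Indep (A : Set V) → M.Indep (B : Set V) →
      (B.filter fun b => b ∈ A ∨ ¬ M.Indep (insert b (A : Set V))).card ≤ A.card := by
    intro M hMA hMB
    by_contra! hlt
    obtain ⟨e, he, heA, hei⟩ := hMA.augment_finset
      (hMB.subset (Finset.coe_subset.2 (Finset.filter_subset _ B))) hlt
    rcases (Finset.mem_filter.1 he).2 with h | h
    exacts [heA h, h hei]
  have h₁ := key M₁ hA.1 hB.1
  have h₂ := key M₂ hA.2 hB.2
  obtain ⟨b, hb, hbn⟩ := Finset.exists_mem_notMem_of_card_lt_card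
    (lt_of_le_of_lt (Finset.card_union_le _ _)
      (lt_of_le_of_lt (Nat.add_le_add h₁ h₂) (by omega : A.card + A.card < B.card)))
  simp only [Finset.mem_union, Finset.mem_filter, hb, true_and, not_or, not_not] at hbn
  exact ⟨b, hbn.1.1, by simpa [CommonIndep] using ⟨hbn.1.2, hbn.2.2⟩⟩

/-! ### Distances of negative type -/

/-- The sum of the distances between the elements of `A` and those of `B`, over ordered pairs. -/
def crossSum {X : Type*} (d : X → X → ℝ) (A B : Finset X) : ℝ :=
  ∑ a ∈ A, ∑ b ∈ B, d a b

section CrossSum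

variable {X : Type*} {d : X → X → ℝ}

lemma dispersion_eq_crossSum (A : Finset X) : dispersion d A = 1 / 2 * crossSum d A A := rfl

lemma crossSum_comm (hd : IsDistance d) (A B : Finset X) : crossSum d A B = crossSum d B A := by
  simp only [crossSum]
  rw [Finset.sum_comm]
  exact Finset.sum_congr rfl fun _ _ => Finset.sum_congr rfl fun _ _ => hd.symm _ _

lemma crossSum_nonneg (hd : IsDistance d) (A B : Finset X) : 0 ≤ crossSum d A B :=
  Finset.sum_nonneg fun _ _ => Finset.sum_nonneg fun _ _ => hd.nonneg _ _

lemma crossSum_exchange [DecidableEq X] (hd : IsDistance d) {A R S : Finset X} (hR : R ⊆ A)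
    (hS : Disjoint S A) :
    crossSum d ((A \ R) ∪ S) ((A \ R) ∪ S) = crossSum d A A + 2 * crossSum d S A -
      2 * crossSum d R A - 2 * crossSum d S R + crossSum d R R + crossSum d S S := by
  have key : ∀ f : X → ℝ, ∑ x ∈ (A \ R) ∪ S, f x = ∑ x ∈ A, f x - ∑ x ∈ R, f x + ∑ x ∈ S, f x := by
    intro f
    rw [Finset.sum_union (Finset.disjoint_left.2 fun x hx hxS =>
      Finset.disjoint_left.1 hS hxS (Finset.mem_sdiff.1 hx).1), Finset.sum_sdiff_eq_sub hR]
  have h1 := crossSum_comm hd S A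
  have h2 := crossSum_comm hd R A
  have h3 := crossSum_comm hd S R
  simp only [crossSum] at *
  simp only [key, Finset.sum_sub_distrib, Finset.sum_add_distrib]
  linarith

/-- The negative type inequality for a combination of two indicator vectors. -/
lemma crossSum_negativeType [Fintype X] (hneg : IsNegativeType d) (hd : IsDistance d)
    (A B : Finset X) :
    (B.card : ℝ) ^ 2 * crossSum d A A + (A.card : ℝ) ^ 2 * crossSum d B B ≤
      2 * A.card * B.card * crossSum d A B := by
  classical
  have key : ∀ S T : Finset X, ∑ x, ∑ y, (if x ∈ S then (1 : ℝ) else 0) * d x y *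
      (if y ∈ T then (1 : ℝ) else 0) = crossSum d S T := by
    intro S T
    simp [crossSum, Finset.sum_ite_mem]
  have h := hneg (fun x => B.card * (if x ∈ A then (1 : ℝ) else 0) -
    A.card * (if x ∈ B then (1 : ℝ) else 0)) (by
      rw [Finset.sum_sub_distrib, ← Finset.mul_sum, ← Finset.mul_sum]
      simp [mul_comm])
  have hexp : ∑ x, ∑ y, (B.card * (if x ∈ A then (1 : ℝ) else 0) -
      A.card * (if x ∈ B then (1 : ℝ) else 0)) * d x y *
      (B.card * (if y ∈ A then (1 : ℝ) else 0) - A.card * (if y ∈ B then (1 : ℝ) else 0)) =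
      (B.card : ℝ) ^ 2 * crossSum d A A - A.card * B.card * crossSum d A B -
        A.card * B.card * crossSum d B A + (A.card : ℝ) ^ 2 * crossSum d B B := by
    rw [← key A A, ← key A B, ← key B A, ← key B B]
    simp only [Finset.mul_sum, ← Finset.sum_sub_distrib, ← Finset.sum_add_distrib]
    exact Finset.sum_congr rfl fun _ _ => Finset.sum_congr rfl fun _ _ => by ring
  rw [hexp, crossSum_comm hd B A] at h
  linarith

/-- The square root of `d` satisfies the triangle inequality, so `d` satisfies it up to a
factor `2`. -/
lemma dist_le_two_mul [Fintype X] (hneg : IsNegativeType d) (hd : IsDistance d) (a b c : X) :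
    d a b ≤ 2 * (d a c + d c b) := by
  classical
  by_cases hab : a = b
  · subst hab
    rw [hd.self]
    have := hd.nonneg a c
    have := hd.nonneg c a
    linarith
  · have h := crossSum_negativeType hneg hd {a, b} {c}
    rw [Finset.card_pair hab, Finset.card_singleton] at h
    simp only [crossSum, Finset.sum_pair hab, Finset.sum_singleton, hd.self, hd.symm b a,
      hd.symm b c] at h
    norm_num at h
    linarith

/-- A reverse Cauchy–Schwarz inequality, from negative type and the inequality of arithmetic and
geometric means. It makes a comparison of the sizes of `A` and `B` unnecessary. -/
lemma crossSum_mul_le_sq [Fintype X] (hneg : IsNegativeType d) (hd : IsDistance d)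
    (A B : Finset X) : crossSum d A A * crossSum d B B ≤ crossSum d A B ^ 2 := by
  rcases A.eq_empty_or_nonempty with rfl | hA
  · simp [crossSum]
  rcases B.eq_empty_or_nonempty with rfl | hB
  · simp [crossSum]
  have hα : (0 : ℝ) < A.card := Nat.cast_pos.2 hA.card_pos
  have hβ : (0 : ℝ) < B.card := Nat.cast_pos.2 hB.card_pos
  have h := crossSum_negativeType hneg hd A B
  have ha := crossSum_nonneg hd A A
  have hb := crossSum_nonneg hd B B
  have hc := crossSum_nonneg hd A B
  generalize crossSum d A A = x at *
  generalize crossSum d B B = y at *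
  generalize crossSum d A B = z at *
  generalize (A.card : ℝ) = α at *
  generalize (B.card : ℝ) = β at *
  have h1 : (β ^ 2 * x + α ^ 2 * y) ^ 2 ≤ (2 * α * β * z) ^ 2 := by
    gcongr
  have h2 : 4 * (α * β) ^ 2 * (x * y) ≤ (β ^ 2 * x + α ^ 2 * y) ^ 2 := by
    nlinarith [sq_nonneg (β ^ 2 * x - α ^ 2 * y)]
  have h3 : (4 * (α * β) ^ 2) * (x * y) ≤ (4 * (α * β) ^ 2) * z ^ 2 := by
    calc _ ≤ _ := h2
      _ ≤ _ := h1
      _ = _ := by ring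
  exact le_of_mul_le_mul_left h3 (by positivity)

/-- Going from `S` to `R` through the elements of `A`. -/
lemma card_mul_crossSum_le [Fintype X] (hneg : IsNegativeType d) (hd : IsDistance d)
    (A R S : Finset X) :
    A.card * crossSum d S R ≤ 2 * (R.card * crossSum d S A + S.card * crossSum d R A) := by
  have h : ∑ s ∈ S, ∑ r ∈ R, ∑ _c ∈ A, d s r ≤
      ∑ s ∈ S, ∑ r ∈ R, ∑ c ∈ A, (2 * d s c + 2 * d r c) := by
    refine Finset.sum_le_sum fun s _ => Finset.sum_le_sum fun r _ => Finset.sum_le_sum fun c _ => ?_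
    have := dist_le_two_mul hneg hd s r c
    rw [hd.symm c r] at this
    linarith
  simp only [Finset.sum_add_distrib, Finset.sum_const, nsmul_eq_mul, ← Finset.mul_sum] at h
  simp only [crossSum]
  linarith

end CrossSum

/-! ### Quality of local search -/

/-- `LocalSearch d M₁ M₂ K i A`: the set `A` is a possible result of `i` rounds of local search from
the empty set, each of which moves to a common independent set at least as good as all those at
Hamming distance at most `K` from the current set. -/
inductive LocalSearch {X : Type*} [DecidableEq X] (d : X → X → ℝ) (M₁ M₂ : Matroid X) (K : ℕ) :
    ℕ → Finset X → Prop
  | zero : LocalSearch d M₁ M₂ K 0 ∅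
  | succ {i : ℕ} {A A' : Finset X} (h : LocalSearch d M₁ M₂ K i A) (hA' : CommonIndep M₁ M₂ A')
      (hbest : ∀ C, CommonIndep M₁ M₂ C → (symmDiff A C).card ≤ K →
        crossSum d C C ≤ crossSum d A' A') : LocalSearch d M₁ M₂ K (i + 1) A'

lemma LocalSearch.commonIndep {X : Type*} [DecidableEq X] {d : X → X → ℝ} {M₁ M₂ : Matroid X}
    {K i : ℕ} {A : Finset X} (h : LocalSearch d M₁ M₂ K i A) :
    CommonIndep M₁ M₂ A := by
  cases h with
  | zero => simp [CommonIndep]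
  | succ h hA' hbest => exact hA'

section LocalSearch

variable {X : Type*} [Fintype X] [DecidableEq X] {d : X → X → ℝ} {M₁ M₂ : Matroid X}

/-- Final comparison, with `x = 1 / p`, of the values `a` and `b` of the two sets and their cross
sum `c`. -/
lemma not_lt_of_cross_bound {x a b c : ℝ} (hx0 : 0 < x) (hx1 : x < 1 / 8) (ha : 0 < a) (hc : 0 ≤ c)
    (hsq : a * b ≤ c ^ 2) (hlin : (1 - x) * c ≤ (1 + x) ^ 3 * a) : ¬ a < (1 - 8 * x) * b := by
  intro hlt
  have h1 : (1 - x) ^ 2 * (a * b) ≤ (1 + x) ^ 6 * a ^ 2 := by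
    calc (1 - x) ^ 2 * (a * b) ≤ (1 - x) ^ 2 * c ^ 2 := by gcongr
      _ = ((1 - x) * c) ^ 2 := by ring
      _ ≤ ((1 + x) ^ 3 * a) ^ 2 := by
        refine pow_le_pow_left₀ (mul_nonneg (by linarith) hc) hlin 2
      _ = _ := by ring
  have h2 : (1 - x) ^ 2 * b ≤ (1 + x) ^ 6 * a := by
    refine le_of_mul_le_mul_left ?_ ha
    linarith
  have hb : 0 < b := by
    by_contra hb
    have := mul_nonpos_of_nonneg_of_nonpos (by linarith : 0 ≤ 1 - 8 * x) (not_lt.1 hb)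
    linarith
  have h3 : 1 - 8 * x ≤ (1 - x) ^ 8 := by
    have := one_add_mul_le_pow (a := -x) (by linarith) 8
    push_cast at this
    rw [← sub_eq_add_neg] at this
    linarith
  have h4 : (1 + x) ^ 6 * (1 - 8 * x) ≤ (1 - x) ^ 2 := by
    calc (1 + x) ^ 6 * (1 - 8 * x) ≤ (1 + x) ^ 6 * (1 - x) ^ 8 := by gcongr
      _ = (1 - x ^ 2) ^ 6 * (1 - x) ^ 2 := by ring
      _ ≤ 1 * (1 - x) ^ 2 := by
        gcongr
        exact pow_le_one₀ (by nlinarith) (by nlinarith)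
      _ = _ := one_mul _
  have h5 : (1 + x) ^ 6 * a < (1 + x) ^ 6 * ((1 - 8 * x) * b) :=
    mul_lt_mul_of_pos_left hlt (by positivity)
  have h6 : (1 + x) ^ 6 * (1 - 8 * x) * b ≤ (1 - x) ^ 2 * b := by gcongr
  linarith

/-- The step for large `A`. The objective is linearized around `A`: the cross terms of a bounded
exchange are negligible compared to the linear ones if `A` is large. -/
lemma exists_improving_exchange (hd : IsDistance d) (hneg : IsNegativeType d)
    (hE₁ : M₁.E = Set.univ) (hE₂ : M₂.E = Set.univ) {A B : Finset X} (hA : CommonIndep M₁ M₂ A)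
    (hB : CommonIndep M₁ M₂ B) {p : ℕ} (hp : 0 < p) (hcard : 2 * p * (p + 1) ≤ A.card) :
    ∃ C, CommonIndep M₁ M₂ C ∧ (symmDiff A C).card ≤ 2 * p + 1 ∧
      (1 - 1 / (p : ℝ)) * crossSum d B A - (1 + 1 / (p : ℝ)) ^ 2 * crossSum d A A ≤
        Fintype.card X * ((crossSum d C C - crossSum d A A) / 2) := by
  have hp' : (0 : ℝ) < p := Nat.cast_pos.2 hp
  have hp1 : (1 : ℝ) ≤ p := Nat.one_le_cast.2 hp
  set x : ℝ := 1 / (p : ℝ) with hx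
  have hx0 : 0 < x := by positivity
  have hx1 : x ≤ 1 := by rw [hx, div_le_one hp']; exact hp1
  have hrow : ∀ y, 0 ≤ ∑ c ∈ A, d y c := fun y => Finset.sum_nonneg fun c _ => hd.nonneg y c
  obtain ⟨R, S, hRA, hSA, hS, hR, hC, hgain⟩ := exists_bounded_exchange hE₁ hE₂ hA hB
    (fun y => (1 - x) * ∑ c ∈ A, d y c) (fun y => (1 + x) * ∑ c ∈ A, d y c)
    (fun y => mul_nonneg (by linarith) (hrow y)) hp
  refine ⟨_, hC, ?_, ?_⟩
  · have hsub : symmDiff A ((A \ R) ∪ S) ⊆ R ∪ S := by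
      intro y
      simp only [Finset.mem_symmDiff, Finset.mem_union, Finset.mem_sdiff]
      tauto
    have := (Finset.card_le_card hsub).trans (Finset.card_union_le R S)
    omega
  · rw [crossSum_exchange hd hRA hSA]
    simp only [← Finset.mul_sum] at hgain
    have hSR := crossSum_nonneg hd S R
    have hRR := crossSum_nonneg hd R R
    have hSS := crossSum_nonneg hd S S
    have hSA0 := crossSum_nonneg hd S A
    have hRA0 := crossSum_nonneg hd R A
    have herr : crossSum d S R ≤ x * (crossSum d S A + crossSum d R A) := by
      have h1 := card_mul_crossSum_le hneg hd A R S
      have h2 : (2 * p * (p + 1) : ℝ) ≤ A.card := by exact_mod_cast hcard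
      have h3 : (R.card : ℝ) ≤ p + 1 := by exact_mod_cast hR
      have h4 : (S.card : ℝ) ≤ p + 1 := by exact_mod_cast hS.trans (Nat.le_succ p)
      have h5 : (2 * p * (p + 1) : ℝ) * crossSum d S R ≤
          2 * ((p + 1) * crossSum d S A + (p + 1) * crossSum d R A) :=
        calc _ ≤ A.card * crossSum d S R := by gcongr
          _ ≤ _ := h1
          _ ≤ _ := by gcongr
      have h6 : (2 * (p + 1) : ℝ) * (p * crossSum d S R) ≤
          (2 * (p + 1)) * (crossSum d S A + crossSum d R A) := by linarith
      have h7 := le_of_mul_le_mul_left h6 (by positivity)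
      rw [hx, one_div, inv_mul_eq_div, le_div_iff₀ hp']
      linarith
    have hlow : (1 - x) * crossSum d B A - (1 + x) ^ 2 * crossSum d A A ≤
        (1 - x) * ∑ y ∈ B \ A, ∑ c ∈ A, d y c -
          (1 + x) * ((1 + x) * ∑ y ∈ A \ B, ∑ c ∈ A, d y c) := by
      have e1 : crossSum d B A = ∑ y ∈ B \ A, ∑ c ∈ A, d y c + crossSum d (A ∩ B) A := by
        rw [crossSum, crossSum, Finset.inter_comm, ← Finset.sum_sdiff (Finset.inter_subset_left
          (s₁ := B) (s₂ := A)), Finset.sdiff_inter_self_left]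
      have e2 : crossSum d A A = ∑ y ∈ A \ B, ∑ c ∈ A, d y c + crossSum d (A ∩ B) A := by
        have := Finset.sum_sdiff (f := fun y => ∑ c ∈ A, d y c)
          (Finset.inter_subset_left (s₁ := A) (s₂ := B))
        rw [Finset.sdiff_inter_self_left] at this
        rw [crossSum, crossSum]
        exact this.symm
      have e3 := crossSum_nonneg hd (A ∩ B) A
      rw [e1, e2]
      nlinarith [mul_nonneg hx0.le e3, mul_nonneg (mul_nonneg hx0.le hx0.le) e3]
    refine hlow.trans (hgain.trans ?_)
    refine mul_le_mul_of_nonneg_left ?_ (Nat.cast_nonneg _)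
    simp only [crossSum] at *
    linarith

/-- The step for small `A` and large `B`. Adding any element to a small set increases its
dispersion by a constant factor, because the distances within `A` are bounded by those to the new
element. -/
lemma exists_improving_insert (hd : IsDistance d) (hneg : IsNegativeType d)
    {A B : Finset X} (hA : CommonIndep M₁ M₂ A) (hB : CommonIndep M₁ M₂ B)
    (hcard : 2 * A.card < B.card) :
    ∃ C, CommonIndep M₁ M₂ C ∧ (symmDiff A C).card ≤ 1 ∧
      (1 + 2 * A.card) * crossSum d A A ≤ 2 * A.card * crossSum d C C := by
  obtain ⟨b, hbA, hC⟩ := exists_commonIndep_insert hA hB hcard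
  refine ⟨_, hC, ?_, ?_⟩
  · have : symmDiff A (insert b A) ⊆ {b} := by
      intro y
      simp only [Finset.mem_symmDiff, Finset.mem_insert, Finset.mem_singleton]
      tauto
    exact Finset.card_le_card this
  · have h1 := crossSum_exchange hd (Finset.empty_subset A)
      (Finset.disjoint_singleton_left.2 hbA)
    rw [Finset.sdiff_empty, Finset.union_comm, ← Finset.insert_eq] at h1
    have h2 : crossSum d A A ≤ ∑ a ∈ A, ∑ a' ∈ A, 2 * (d a b + d b a') :=
      Finset.sum_le_sum fun a _ => Finset.sum_le_sum fun a' _ => dist_le_two_mul hneg hd a a' b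
    have h3 : ∑ a ∈ A, d a b = ∑ a ∈ A, d b a := Finset.sum_congr rfl fun _ _ => hd.symm _ _
    simp only [← Finset.mul_sum, Finset.sum_add_distrib, Finset.sum_const, nsmul_eq_mul, h3] at h2
    rw [h1]
    simp only [crossSum, Finset.sum_singleton, Finset.sum_empty, hd.self] at h2 ⊢
    simp
    nlinarith [Finset.sum_nonneg (s := A) fun c _ => hd.nonneg b c]

/-- A set which is not nearly optimal has a neighbour which is better by a factor whose excess
over `1` is polynomially bounded from below. -/
theorem exists_improving_neighbour (hd : IsDistance d) (hneg : IsNegativeType d)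
    (hE₁ : M₁.E = Set.univ) (hE₂ : M₂.E = Set.univ) {A B : Finset X} (hA : CommonIndep M₁ M₂ A)
    (hB : CommonIndep M₁ M₂ B) {p : ℕ} (hp : 0 < p) (hpos : 0 < crossSum d A A)
    (hlt : crossSum d A A < (1 - 8 / (p : ℝ)) * crossSum d B B) :
    ∃ C, CommonIndep M₁ M₂ C ∧ (symmDiff A C).card ≤ 6 * p * (p + 1) ∧
      (1 + 1 / ((6 * p * (p + 1) : ℕ) * Fintype.card X : ℝ)) * crossSum d A A < crossSum d C C := by
  have hp' : (0 : ℝ) < p := Nat.cast_pos.2 hp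
  have hB0 := crossSum_nonneg hd B B
  have hp8 : (8 : ℝ) < p := by
    by_contra! hle
    have : 1 - 8 / (p : ℝ) ≤ 0 := by
      rw [sub_nonpos, le_div_iff₀ hp']
      linarith
    have := mul_nonpos_of_nonpos_of_nonneg this hB0
    linarith
  have hXne : Nonempty X := by
    by_contra hX
    rw [not_nonempty_iff] at hX
    simp [crossSum, Finset.eq_empty_of_isEmpty A] at hpos
  have hcardX : (1 : ℝ) ≤ Fintype.card X := Nat.one_le_cast.2 Fintype.card_pos
  set K : ℕ := 6 * p * (p + 1) with hK
  have hKr : (K : ℝ) = 6 * p * (p + 1) := by rw [hK]; push_cast; ring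
  set η : ℝ := 1 / (K * Fintype.card X : ℝ) with hη
  have hKpos : (0 : ℝ) < K := by rw [hKr]; positivity
  have hηX : Fintype.card X * η = 1 / K := by
    rw [hη]
    field_simp
  have hη0 : 0 < η := by positivity
  have hηK : η ≤ 1 / K := by
    rw [← hηX]
    exact le_mul_of_one_le_left hη0.le hcardX
  by_contra! hloc
  have hloc' : ∀ C, CommonIndep M₁ M₂ C → (symmDiff A C).card ≤ K →
      crossSum d C C ≤ (1 + 1 / K) * crossSum d A A := by
    intro C hC hcard
    refine (hloc C hC hcard).trans ?_
    gcongr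
  have hKp : 1 / (K : ℝ) ≤ 1 / p / 12 := by
    rw [hKr, div_div, div_le_div_iff₀ (by positivity) (by positivity)]
    nlinarith
  set x : ℝ := 1 / (p : ℝ) with hx
  have hx0 : 0 < x := by positivity
  have hx1 : x < 1 / 8 := by
    rw [hx, div_lt_div_iff₀ hp' (by norm_num)]
    linarith
  rw [show 8 / (p : ℝ) = 8 * x by rw [hx]; ring] at hlt
  -- From size `2 * p * (p + 1)` on, the cross terms cost only a factor `1 ± x`. Below it, `A` and
  -- a set `B` of at most twice its size differ in at most `K` elements.
  rcases Nat.lt_or_ge A.card (2 * p * (p + 1)) with hsmall | hlarge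
  · rcases Nat.lt_or_ge (2 * A.card) B.card with hbig | hle
    · obtain ⟨C, hC, hC1, hCV⟩ := exists_improving_insert hd hneg hA hB hbig
      have hCK := hloc' C hC (hC1.trans (by
        have : 0 < K := by exact_mod_cast hKpos
        omega))
      have hcardlt : 3 * (A.card : ℝ) < K := by
        have : 3 * A.card < K := by rw [hK]; nlinarith
        exact_mod_cast this
      have hA0 : (0 : ℝ) ≤ A.card := Nat.cast_nonneg _
      have h1 : (1 + 2 * A.card) * crossSum d A A ≤
          2 * A.card * ((1 + 1 / K) * crossSum d A A) :=
        hCV.trans (mul_le_mul_of_nonneg_left hCK (by positivity))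
      have h2 : (2 * A.card : ℝ) * (1 / K) < 1 := by
        rw [mul_one_div, div_lt_one hKpos]
        linarith
      nlinarith
    · have hBK : (symmDiff A B).card ≤ K := by
        have h1 : symmDiff A B ⊆ A ∪ B := by
          intro y
          simp only [Finset.mem_symmDiff, Finset.mem_union]
          tauto
        have h2 := (Finset.card_le_card h1).trans (Finset.card_union_le A B)
        have h3 : 3 * A.card ≤ K := by rw [hK]; nlinarith
        omega
      have h1 := hloc' B hB hBK
      have h2 : (1 - 8 * x) * crossSum d B B ≤ (1 - 8 * x) * ((1 + x / 12) * crossSum d A A) := by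
        refine mul_le_mul_of_nonneg_left (h1.trans ?_) (by linarith)
        gcongr
      nlinarith [mul_pos hx0 hpos, mul_pos hx0 (mul_pos hx0 hpos)]
  · obtain ⟨C, hC, hCcard, hCV⟩ :=
      exists_improving_exchange (d := d) hd hneg hE₁ hE₂ hA hB hp hlarge
    have hCη := hloc C hC (hCcard.trans (by rw [hK]; nlinarith))
    refine not_lt_of_cross_bound hx0 hx1 hpos (crossSum_nonneg hd A B)
      (crossSum_mul_le_sq hneg hd A B) ?_ hlt
    rw [crossSum_comm hd A B]
    have h1 : Fintype.card X * ((crossSum d C C - crossSum d A A) / 2) ≤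
        1 / K * crossSum d A A / 2 := by
      rw [← hηX, mul_assoc, mul_div_assoc]
      refine mul_le_mul_of_nonneg_left ?_ (Nat.cast_nonneg _)
      linarith
    have h2 : 1 / K * crossSum d A A / 2 ≤ x * crossSum d A A := by
      nlinarith
    nlinarith [mul_pos hx0 hpos, mul_pos hx0 (mul_pos hx0 hpos),
      mul_pos hx0 (mul_pos hx0 (mul_pos hx0 hpos))]

/-- The first round finds all common independent pairs, hence a set whose dispersion is within a
factor `n ^ 2` of the maximum. Every further round improves it by a fixed fraction of that first
value, until the current set is nearly optimal. -/
lemma LocalSearch.progress (hd : IsDistance d) (hneg : IsNegativeType d)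
    (hE₁ : M₁.E = Set.univ) (hE₂ : M₂.E = Set.univ) {B : Finset X} (hB : CommonIndep M₁ M₂ B)
    {p : ℕ} (hp : 0 < p) {i : ℕ} {A : Finset X}
    (h : LocalSearch d M₁ M₂ (6 * p * (p + 1)) (i + 1) A) :
    (1 - 8 / (p : ℝ)) * crossSum d B B ≤ crossSum d A A ∨
      (1 + i * (1 / ((6 * p * (p + 1) : ℕ) * Fintype.card X : ℝ))) * crossSum d B B ≤
        (Fintype.card X : ℝ) ^ 2 * crossSum d A A := by
  have hB0 := crossSum_nonneg hd B B
  induction i generalizing A with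
  | zero =>
    right
    cases h with
    | succ h hA' hbest =>
      cases h
      have hpair : ∀ a ∈ B, ∀ b ∈ B, d a b ≤ crossSum d A A := by
        intro a ha b hb
        by_cases hab : a = b
        · rw [hab, hd.self]
          exact crossSum_nonneg hd A A
        have hsub : ({a, b} : Finset X) ⊆ B := by
          intro y hy
          rcases Finset.mem_insert.1 hy with rfl | hy
          · exact ha
          · rwa [Finset.mem_singleton.1 hy]
        have h1 := hbest {a, b} ⟨hB.1.subset (Finset.coe_subset.2 hsub),
          hB.2.subset (Finset.coe_subset.2 hsub)⟩ (by
            rw [← Finset.bot_eq_empty, bot_symmDiff, Finset.card_pair hab]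
            nlinarith)
        refine le_trans ?_ h1
        simp only [crossSum, Finset.sum_pair hab, hd.self]
        linarith [hd.nonneg a b, hd.nonneg b a]
      have h2 : crossSum d B B ≤ ∑ a ∈ B, ∑ b ∈ B, crossSum d A A :=
        Finset.sum_le_sum fun a ha => Finset.sum_le_sum fun b hb => hpair a ha b hb
      simp only [Finset.sum_const, nsmul_eq_mul] at h2
      have h3 : (B.card : ℝ) ≤ Fintype.card X := Nat.cast_le.2 (Finset.card_le_univ B)
      have h4 := crossSum_nonneg hd A A
      simp only [Nat.cast_zero, zero_mul, add_zero, one_mul]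
      calc crossSum d B B ≤ (B.card : ℝ) ^ 2 * crossSum d A A := by linarith
        _ ≤ _ := by gcongr
  | succ i ih =>
    cases h with
    | succ h hA' hbest =>
      rename_i A₀
      have hA₀ := h.commonIndep
      have hmono : crossSum d A₀ A₀ ≤ crossSum d A A := hbest A₀ hA₀ (by simp)
      rcases ih h with hgood | hprog
      · exact Or.inl (hgood.trans hmono)
      by_cases hgood : (1 - 8 / (p : ℝ)) * crossSum d B B ≤ crossSum d A₀ A₀
      · exact Or.inl (hgood.trans hmono)
      right
      set η : ℝ := 1 / ((6 * p * (p + 1) : ℕ) * Fintype.card X : ℝ) with hη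
      have hη0 : 0 ≤ η := by positivity
      have hi0 : (0 : ℝ) ≤ i := Nat.cast_nonneg i
      have hBA : crossSum d B B ≤ (Fintype.card X : ℝ) ^ 2 * crossSum d A₀ A₀ := by
        nlinarith [mul_nonneg (mul_nonneg hi0 hη0) hB0]
      have hpos : 0 < crossSum d A₀ A₀ := by
        refine lt_of_le_of_ne (crossSum_nonneg hd _ _) fun h0 => hgood ?_
        rw [← h0, mul_zero] at hBA
        rw [le_antisymm hBA hB0, mul_zero]
        exact crossSum_nonneg hd _ _
      obtain ⟨C, hC, hCcard, hCV⟩ := exists_improving_neighbour hd hneg hE₁ hE₂ hA₀ hB hp hpos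
        (not_le.1 hgood)
      have h5 := hCV.le.trans (hbest C hC hCcard)
      rw [← hη] at h5
      have h6 : (Fintype.card X : ℝ) ^ 2 * ((1 + η) * crossSum d A₀ A₀) ≤
          (Fintype.card X : ℝ) ^ 2 * crossSum d A A := by gcongr
      push_cast
      nlinarith [mul_le_mul_of_nonneg_left hBA hη0]

/-- Polynomially many rounds of local search suffice. -/
theorem LocalSearch.isApproxSolution (hd : IsDistance d) (hneg : IsNegativeType d)
    (hE₁ : M₁.E = Set.univ) (hE₂ : M₂.E = Set.univ) {p : ℕ} (hp : 0 < p) {ε : ℝ}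
    (hpε : 8 ≤ p * ε) {i : ℕ} (hi : 6 * p * (p + 1) * Fintype.card X ^ 3 ≤ i) {A : Finset X}
    (h : LocalSearch d M₁ M₂ (6 * p * (p + 1)) (i + 1) A) : IsApproxSolution d M₁ M₂ ε A := by
  refine ⟨h.commonIndep, fun B hB => ?_⟩
  have hp' : (0 : ℝ) < p := Nat.cast_pos.2 hp
  have hB0 := crossSum_nonneg hd B B
  have hε : 8 / (p : ℝ) ≤ ε := by
    rw [div_le_iff₀ hp']
    linarith
  suffices hmain : (1 - 8 / (p : ℝ)) * crossSum d B B ≤ crossSum d A A by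
    rw [dispersion_eq_crossSum, dispersion_eq_crossSum]
    have : (1 - ε) * crossSum d B B ≤ (1 - 8 / (p : ℝ)) * crossSum d B B := by gcongr
    linarith
  rcases h.progress hd hneg hE₁ hE₂ hB hp with h1 | h1
  · exact h1
  have hle : crossSum d B B ≤ crossSum d A A := by
    rcases isEmpty_or_nonempty X with hX | hX
    · rw [Finset.eq_empty_of_isEmpty A, Finset.eq_empty_of_isEmpty B]
    have hX' : (0 : ℝ) < Fintype.card X := Nat.cast_pos.2 Fintype.card_pos
    have hi' : ((6 * p * (p + 1) : ℕ) : ℝ) * (Fintype.card X : ℝ) ^ 3 ≤ i := by exact_mod_cast hi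
    have hK : (0 : ℝ) < (6 * p * (p + 1) : ℕ) := Nat.cast_pos.2 (by positivity)
    have h2 : (Fintype.card X : ℝ) ^ 2 ≤
        i * (1 / ((6 * p * (p + 1) : ℕ) * Fintype.card X : ℝ)) := by
      rw [mul_one_div, le_div_iff₀ (by positivity)]
      calc _ = _ := by ring
        _ ≤ _ := hi'
    have h3 : (Fintype.card X : ℝ) ^ 2 * crossSum d B B ≤
        (Fintype.card X : ℝ) ^ 2 * crossSum d A A := by
      refine le_trans ?_ h1
      gcongr
      linarith
    exact le_of_mul_le_mul_left h3 (by positivity)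
  refine le_trans ?_ hle
  have : 0 ≤ 8 / (p : ℝ) := by positivity
  nlinarith [mul_nonneg this hB0]

end LocalSearch

/-! ### Total correctness of programs with time bounds -/

section Runs

variable {n : ℕ} {d : Fin n → Fin n → ℝ} {M₁ M₂ : Matroid (Fin n)}

/-- Started in memory `s`, the program `P` halts after at most `t` steps in a memory satisfying
`Q`. -/
def Runs (d : Fin n → Fin n → ℝ) (M₁ M₂ : Matroid (Fin n)) (P : Prog) (t : ℕ) (s : State)
    (Q : State → Prop) : Prop :=
  ∃ s' t', Exec d M₁ M₂ P s s' t' ∧ t' ≤ t ∧ Q s'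

/-- A nonempty sequence of instructions. -/
def block : Instr → List Instr → Prog
  | i, [] => .instr i
  | i, j :: l => .seq (.instr i) (block j l)

lemma Runs.block {Q : State → Prop} (i : Instr) (l : List Instr) {s : State}
    (h : Q (l.foldl (fun s j => j.run d M₁ M₂ s) (i.run d M₁ M₂ s))) :
    Runs d M₁ M₂ (block i l) (l.length + 1) s Q := by
  induction l generalizing i s with
  | nil => exact ⟨_, _, .instr i s, le_rfl, h⟩
  | cons j l ih =>
    obtain ⟨s', t', he, ht, hQ⟩ := ih j h
    exact ⟨s', _, .seq (.instr i s) he, by simp only [List.length_cons]; omega, hQ⟩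

lemma Runs.mono {P : Prog} {t t' : ℕ} {s : State} {Q Q' : State → Prop}
    (h : Runs d M₁ M₂ P t s Q) (ht : t ≤ t') (hQ : ∀ s', Q s' → Q' s') :
    Runs d M₁ M₂ P t' s Q' := by
  obtain ⟨s', u, he, hu, hq⟩ := h
  exact ⟨s', u, he, hu.trans ht, hQ s' hq⟩

lemma Runs.seq {P P' : Prog} {t t' : ℕ} {s : State} {R Q : State → Prop}
    (h : Runs d M₁ M₂ P t s R) (h' : ∀ s', R s' → Runs d M₁ M₂ P' t' s' Q) :
    Runs d M₁ M₂ (.seq P P') (t + t') s Q := by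
  obtain ⟨s', u, he, hu, hr⟩ := h
  obtain ⟨s'', u', he', hu', hq⟩ := h' s' hr
  exact ⟨s'', _, .seq he he', Nat.add_le_add hu hu', hq⟩

lemma Runs.ite {c : Test} {P P' : Prog} {t : ℕ} {s : State} {Q : State → Prop}
    (h : c.holds s → Runs d M₁ M₂ P t s Q) (h' : ¬ c.holds s → Runs d M₁ M₂ P' t s Q) :
    Runs d M₁ M₂ (.ite c P P') (t + 1) s Q := by
  by_cases hc : c.holds s
  · obtain ⟨s', u, he, hu, hq⟩ := h hc
    exact ⟨s', _, .ite_true hc he, Nat.succ_le_succ hu, hq⟩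
  · obtain ⟨s', u, he, hu, hq⟩ := h' hc
    exact ⟨s', _, .ite_false hc he, Nat.succ_le_succ hu, hq⟩

/-- A loop with an invariant indexed by the number of rounds, which is known to be `N`. -/
lemma Runs.loop {c : Test} {P : Prog} {t : ℕ} (N : ℕ) (I : ℕ → State → Prop) {s : State}
    (h0 : I 0 s)
    (hstep : ∀ k < N, ∀ s, I k s → c.holds s ∧ Runs d M₁ M₂ P t s (I (k + 1)))
    (hfinal : ∀ s, I N s → ¬ c.holds s) :
    Runs d M₁ M₂ (.loop c P) (N * (t + 1) + 1) s (I N) := by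
  have key : ∀ m k, m + k = N → ∀ s, I k s →
      Runs d M₁ M₂ (.loop c P) (m * (t + 1) + 1) s (I N) := by
    intro m
    induction m with
    | zero =>
      intro k hk s hI
      obtain rfl : k = N := by omega
      exact ⟨s, 1, by constructor; exact hfinal s hI, by omega, hI⟩
    | succ m ih =>
      intro k hk s hI
      obtain ⟨hc, s', u, he, hu, hI'⟩ := hstep k (by omega) s hI
      obtain ⟨s'', u', he', hu', hq⟩ := ih (k + 1) (by omega) s' hI'
      refine ⟨s'', _, .loop_step hc he he', ?_, hq⟩
      rw [Nat.succ_mul]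
      omega
  exact key N 0 rfl s h0

end Runs

/-! ### The local search program -/

/-- Copy the first `n` entries of array `src` to array `dst`. -/
def copyArr (src dst : ℕ) : Prog :=
  .seq (block (.const 11 0) [])
    (.loop (.lt 11 0) (block (.load 12 src 11) [.store dst 11 12, .add 11 11 1]))

/-- Divide register `7` by `n + 1`, leaving the remainder in register `7` and the quotient in
register `9`. -/
def divMod : Prog :=
  .seq (block (.const 9 0) [])
    (.loop (.lt 0 7) (block (.sub 7 7 3) [.add 9 9 1]))

/-- Toggle the membership in array `1` of the elements whose numbers are the last digits, as many
as register `2` says, of register `6` in base `n + 1`. The digit `n` is not the number of an element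
and has no effect. -/
def toggleDigits : Prog :=
  .seq (block (.copy 7 6) [.const 8 0])
    (.loop (.lt 8 2) (.seq divMod
      (block (.load 10 1 7) [.sub 10 1 10, .store 1 7 10, .copy 7 9, .add 8 8 1])))

/-- Add to real register `3` the distances from the element in register `15` to the elements of the
set in array `1`. -/
def sumRow : Prog :=
  .seq (block (.const 16 0) [])
    (.loop (.lt 16 0) (.seq (block (.load 17 1 16) [])
      (.seq (.ite (.lt 18 17) (block (.dist 4 15 16) [.radd 3 3 4]) (block (.const 17 0) []))
        (block (.add 16 16 1) []))))

/-- Store twice the dispersion of the set in array `1` in real register `3`. -/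
def evaluate : Prog :=
  .seq (block (.const 18 0) [.const 15 0, .rsub 3 3 3])
    (.loop (.lt 15 0) (.seq (block (.load 17 1 15) [])
      (.seq (.ite (.lt 18 17) sumRow (block (.const 17 0) [])) (block (.add 15 15 1) []))))

/-- Compare the neighbour encoded by register `6` of the current set, in array `0`, with the best
set so far, in array `2`, whose value is in real register `2`. -/
def tryNeighbour : Prog :=
  .seq (copyArr 0 1) (.seq toggleDigits
    (.seq (block (.indep₁ 13 1) [.indep₂ 14 1, .add 13 13 14])
      (.seq (.ite (.lt 1 13)
          (.seq evaluate (.ite (.rlt 2 3) (.seq (copyArr 1 2) (block (.rcopy 2 3) []))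
            (block (.const 17 0) [])))
          (block (.const 17 0) []))
        (block (.add 6 6 1) []))))

/-- One round of local search: try all neighbours and move to the best one. -/
def searchRound : Prog :=
  .seq (block (.const 6 0) []) (.seq (.loop (.lt 6 4) tryNeighbour)
    (.seq (copyArr 2 0) (block (.add 5 5 1) [])))

/-- With `p` the least number such that `p * ε ≥ 8`, store the radius `6 * p * (p + 1)` of the
neighbourhood in register `2`. The radius is computed as the sum of `12 * k` for `k` from `1` to
`p`. -/
def setRadius : Prog :=
  .seq (block (.const 1 1) [.rone 1, .radd 1 1 1, .radd 1 1 1, .radd 1 1 1, .const 7 0,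
      .const 8 12])
    (.loop (.rlt 3 1) (block (.add 7 7 8) [.add 2 2 7, .radd 3 3 0]))

/-- Store the power of `n + 1` whose exponent is in register `2` in register `4`. It bounds both the
codes of neighbours and the number of rounds. -/
def setPower : Prog :=
  .seq (block (.add 3 0 1) [.const 4 1, .const 9 0])
    (.loop (.lt 9 2) (.seq (block (.const 10 0) [.const 11 0])
      (.seq (.loop (.lt 11 3) (block (.add 10 10 4) [.add 11 11 1]))
        (block (.copy 4 10) [.add 9 9 1]))))

/-- The approximation scheme. -/
def approximationScheme : Prog :=
  .seq setRadius (.seq setPower (.seq (block (.const 5 0) []) (.loop (.lt 5 4) searchRound)))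

/-! ### Encoding of the neighbourhood -/

/-- The set of elements whose numbers occur an odd number of times among the last `k` digits of `x`
in base `n + 1`. -/
def digitSet (n : ℕ) : ℕ → ℕ → Finset (Fin n)
  | 0, _ => ∅
  | k + 1, x => symmDiff (Finset.univ.filter fun v : Fin n => (v : ℕ) = x % (n + 1))
      (digitSet n k (x / (n + 1)))

/-- The effect on an indicator array of toggling the last `k` digits of `x` in base `n + 1`. -/
def toggleArr (n : ℕ) : ℕ → ℕ → (ℕ → ℕ) → ℕ → ℕ
  | 0, _, f => f
  | k + 1, x, f => toggleArr n k (x / (n + 1))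
      (Function.update f (x % (n + 1)) (1 - f (x % (n + 1))))

lemma toggleArr_ne_zero_iff {n : ℕ} (k x : ℕ) (f : ℕ → ℕ) (v : Fin n) :
    toggleArr n k x f v ≠ 0 ↔ Xor (f v ≠ 0) (v ∈ digitSet n k x) := by
  induction k generalizing x f with
  | zero => simp [toggleArr, digitSet]
  | succ k ih =>
    rw [toggleArr, ih, digitSet, Finset.mem_symmDiff, Finset.mem_filter]
    by_cases hv : (v : ℕ) = x % (n + 1)
    · rw [← hv, Function.update_self]
      simp only [Xor, Finset.mem_univ, true_and, not_true_eq_false, and_false, or_false]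
      by_cases hf : f v = 0
      · simp [hf]
      · simp [hf, Nat.one_le_iff_ne_zero]
    · rw [Function.update_of_ne hv]
      simp [hv]

lemma exists_digitSet_eq {n : ℕ} (k : ℕ) (D : Finset (Fin n)) (hD : D.card ≤ k) :
    ∃ x < (n + 1) ^ k, digitSet n k x = D := by
  induction k generalizing D with
  | zero => exact ⟨0, by simp, by simp_all [digitSet]⟩
  | succ k ih =>
    -- The first digit `r`, and the set `D'` for the others.
    obtain ⟨r, D', hr, hD', hsym⟩ : ∃ r D', r < n + 1 ∧ D'.card ≤ k ∧
        symmDiff (Finset.univ.filter fun v : Fin n => (v : ℕ) = r) D' = D := by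
      rcases D.eq_empty_or_nonempty with rfl | ⟨v, hv⟩
      · refine ⟨n, ∅, Nat.lt_succ_self n, by simp, ?_⟩
        rw [← Finset.bot_eq_empty, symmDiff_bot]
        simp only [Finset.bot_eq_empty, Finset.filter_eq_empty_iff]
        intro v _
        exact v.2.ne
      · refine ⟨v, D.erase v, by omega, by rw [Finset.card_erase_of_mem hv]; omega, ?_⟩
        ext w
        simp only [Finset.mem_symmDiff, Finset.mem_filter, Finset.mem_univ, true_and,
          Finset.mem_erase, ← Fin.ext_iff]
        by_cases hw : w = v
        · simp [hw, hv]
        · simp [hw]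
    obtain ⟨x, hx, hxD⟩ := ih D' hD'
    refine ⟨r + (n + 1) * x, ?_, ?_⟩
    · calc r + (n + 1) * x < (n + 1) + (n + 1) * x := by omega
        _ = (n + 1) * (x + 1) := by ring
        _ ≤ (n + 1) * (n + 1) ^ k := Nat.mul_le_mul_left _ hx
        _ = (n + 1) ^ (k + 1) := by ring
    · rw [digitSet, Nat.add_mul_mod_self_left, Nat.mod_eq_of_lt hr,
        Nat.add_mul_div_left _ _ (Nat.succ_pos n), Nat.div_eq_of_lt hr, zero_add, hxD, hsym]

/-! ### Verification of the program -/

section Verification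

variable {n : ℕ} {d : Fin n → Fin n → ℝ} {M₁ M₂ : Matroid (Fin n)}

/-- `Frame b r s s'`: the natural registers below `b` and the real registers below `r` agree. -/
def Frame (b r : ℕ) (s s' : State) : Prop :=
  (∀ x < b, s'.nat x = s.nat x) ∧ ∀ x < r, s'.real x = s.real x

lemma Frame.trans {b r : ℕ} {s s' s'' : State} (h : Frame b r s s') (h' : Frame b r s' s'') :
    Frame b r s s'' :=
  ⟨fun x hx => (h'.1 x hx).trans (h.1 x hx), fun x hx => (h'.2 x hx).trans (h.2 x hx)⟩

lemma Frame.mono {b r b' r' : ℕ} {s s' : State} (h : Frame b r s s') (hb : b' ≤ b) (hr : r' ≤ r) :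
    Frame b' r' s s' :=
  ⟨fun x hx => h.1 x (hx.trans_le hb), fun x hx => h.2 x (hx.trans_le hr)⟩

lemma runs_copyArr {src dst : ℕ} (hne : src ≠ dst) {s : State} (h0 : s.nat 0 = n)
    (h1 : s.nat 1 = 1) :
    Runs d M₁ M₂ (copyArr src dst) (4 * n + 2) s fun s' =>
      Frame 11 4 s s' ∧ (∀ a ≠ dst, s'.arr a = s.arr a) ∧ ∀ i < n, s'.arr dst i = s.arr src i := by
  refine (Runs.seq (t := 1) (t' := n * (3 + 1) + 1) (Runs.block _ _ ?_) fun s' hs' =>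
    (Runs.loop n (fun k s' => s'.nat 11 = k ∧ Frame 11 4 s s' ∧
      (∀ a ≠ dst, s'.arr a = s.arr a) ∧ ∀ i < k, s'.arr dst i = s.arr src i) hs' ?_ ?_).mono le_rfl
      fun s' h => h.2).mono (by omega) fun _ h => h
  · refine ⟨by simp [Instr.run], ⟨fun x hx => ?_, fun x _ => by simp [Instr.run]⟩, by simp [Instr.run],
      by simp⟩
    simp [Instr.run, hx.ne]
  · rintro k hk s' ⟨hk', hF, harr, hdst⟩
    have e0 := hF.1 0 (by omega)
    have e1 := hF.1 1 (by omega)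
    refine ⟨by simp only [Test.holds]; omega, Runs.block _ _ ⟨?_, ⟨fun x hx => ?_, fun x hx => ?_⟩,
      fun a ha => ?_, fun i hi => ?_⟩⟩
    · simp [Instr.run, hk', e1, h1]
    · have h11 : x ≠ 11 := by omega
      have h12 : x ≠ 12 := by omega
      simp [Instr.run, h11, h12, hF.1 x hx]
    · simp [Instr.run, hF.2 x hx]
    · simp [Instr.run, ha, harr a ha]
    · by_cases hik : i = k
      · simp [Instr.run, hik, hk', harr src hne]
      · simp [Instr.run, hk', hik, hdst i (by omega)]
  · rintro s' ⟨hk', hF, -⟩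
    have e0 := hF.1 0 (by omega)
    simp only [Test.holds]
    omega

lemma runs_divMod {s : State} (h0 : s.nat 0 = n) (h1 : s.nat 1 = 1) (h3 : s.nat 3 = n + 1) :
    Runs d M₁ M₂ divMod (3 * s.nat 7 + 2) s fun s' =>
      Frame 7 4 s s' ∧ s'.nat 8 = s.nat 8 ∧ s'.arr = s.arr ∧
        s'.nat 7 = s.nat 7 % (n + 1) ∧ s'.nat 9 = s.nat 7 / (n + 1) := by
  set x := s.nat 7 with hx
  have hdm := Nat.div_add_mod x (n + 1)
  have hmod : x % (n + 1) < n + 1 := Nat.mod_lt x (Nat.succ_pos n)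
  have hle := Nat.div_le_self x (n + 1)
  refine (Runs.seq (t := 1) (t' := (x / (n + 1)) * (2 + 1) + 1) (Runs.block _ _ ?_) fun s' hs' =>
    (Runs.loop (x / (n + 1)) (fun k s' => Frame 7 4 s s' ∧ s'.nat 8 = s.nat 8 ∧
      s'.arr = s.arr ∧ s'.nat 7 = x - (n + 1) * k ∧ s'.nat 9 = k) hs' ?_ ?_).mono le_rfl
      fun s' h => ?_).mono (by omega) fun _ h => h
  · refine ⟨⟨fun y hy => ?_, fun y _ => by simp [Instr.run]⟩, by simp [Instr.run],
      by simp [Instr.run], by simp [Instr.run, hx], by simp [Instr.run]⟩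
    have h9 : y ≠ 9 := by omega
    simp [Instr.run, h9]
  · rintro k hk s' ⟨hF, h8, harr, h7, h9⟩
    have e0 := hF.1 0 (by omega)
    have e1 := hF.1 1 (by omega)
    have e3 := hF.1 3 (by omega)
    have hk2 : (n + 1) * (k + 1) ≤ (n + 1) * (x / (n + 1)) := Nat.mul_le_mul_left _ hk
    have hk3 : (n + 1) * (k + 1) = (n + 1) * k + (n + 1) := by ring
    refine ⟨by simp only [Test.holds]; omega, Runs.block _ _ ⟨⟨fun y hy => ?_, fun y hy => ?_⟩,
      ?_, ?_, ?_, ?_⟩⟩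
    · have h7' : y ≠ 7 := by omega
      have h9' : y ≠ 9 := by omega
      simp [Instr.run, h7', h9', hF.1 y hy]
    · simp [Instr.run, hF.2 y hy]
    · simp [Instr.run, h8]
    · simp [Instr.run, harr]
    · simp [Instr.run, h7, e3, h3]
      omega
    · simp [Instr.run, h9, e1, h1]
  · rintro s' ⟨hF, -, -, h7, -⟩
    have e0 := hF.1 0 (by omega)
    simp only [Test.holds]
    omega
  · obtain ⟨hF, h8, harr, h7, h9⟩ := h
    exact ⟨hF, h8, harr, by omega, h9⟩

/-- A time bound for `toggleDigits`. -/
def toggleTime (K N : ℕ) : ℕ := K * (3 * N + 8) + 3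

lemma runs_toggleDigits {s : State} {K N : ℕ} (h0 : s.nat 0 = n) (h1 : s.nat 1 = 1)
    (h2 : s.nat 2 = K) (h3 : s.nat 3 = n + 1) (h6 : s.nat 6 ≤ N) :
    Runs d M₁ M₂ toggleDigits (toggleTime K N) s fun s' =>
      Frame 7 4 s s' ∧ (∀ a ≠ 1, s'.arr a = s.arr a) ∧
        s'.arr 1 = toggleArr n K (s.nat 6) (s.arr 1) := by
  refine (Runs.seq (t := 2) (t' := K * (3 * N + 2 + 5 + 1) + 1) (Runs.block _ _ ?_) fun s' hs' =>
    (Runs.loop K (fun k s' => Frame 7 4 s s' ∧ (∀ a ≠ 1, s'.arr a = s.arr a) ∧ s'.nat 8 = k ∧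
      s'.nat 7 ≤ N ∧ toggleArr n (K - k) (s'.nat 7) (s'.arr 1) =
        toggleArr n K (s.nat 6) (s.arr 1)) hs' ?_ ?_).mono le_rfl fun s' h => ?_).mono
      (by rw [toggleTime, show 3 * N + 2 + 5 + 1 = 3 * N + 8 by omega]; omega) fun _ h => h
  · refine ⟨⟨fun y hy => ?_, fun y _ => by simp [Instr.run]⟩, by simp [Instr.run],
      by simp [Instr.run], by simp [Instr.run, h6], by simp [Instr.run]⟩
    have h7 : y ≠ 7 := by omega
    have h8 : y ≠ 8 := by omega
    simp [Instr.run, h7, h8]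
  · rintro k hk s' ⟨hF, harr, h8, h7, htog⟩
    have e0 := hF.1 0 (by omega)
    have e1 := hF.1 1 (by omega)
    have e2 := hF.1 2 (by omega)
    have e3 := hF.1 3 (by omega)
    refine ⟨by simp only [Test.holds]; omega, Runs.seq (t' := 5)
      ((runs_divMod (e0.trans h0) (e1.trans h1) (e3.trans h3)).mono (by omega) fun _ h => h) ?_⟩
    rintro s'' ⟨hF', h8', harr', h7', h9'⟩
    have f1 := hF'.1 1 (by omega)
    refine Runs.block _ _ ⟨⟨fun y hy => ?_, fun y hy => ?_⟩, fun a ha => ?_, ?_, ?_, ?_⟩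
    · have g7 : y ≠ 7 := by omega
      have g8 : y ≠ 8 := by omega
      have g10 : y ≠ 10 := by omega
      simp [Instr.run, g7, g8, g10, hF'.1 y hy, hF.1 y hy]
    · simp [Instr.run, hF'.2 y hy, hF.2 y hy]
    · simp [Instr.run, ha, harr', harr a ha]
    · simp [Instr.run, h8', h8, f1, e1, h1]
    · simp only [List.foldl, Instr.run]
      simp [h9']
      exact (Nat.div_le_self _ _).trans h7
    · rw [← htog, show K - k = K - (k + 1) + 1 by omega, toggleArr]
      simp [Instr.run, h9', h7', harr', f1, e1, h1]
  · rintro s' ⟨hF, -, h8, -⟩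
    have e2 := hF.1 2 (by omega)
    simp only [Test.holds]
    omega
  · obtain ⟨hF, harr, -, -, htog⟩ := h
    rw [Nat.sub_self] at htog
    exact ⟨hF, harr, htog⟩

lemma mem_setOf {s : State} {a : ℕ} {v : Fin n} : v ∈ s.setOf n a ↔ s.arr a v ≠ 0 := by
  simp [State.setOf]

lemma crossSum_setOf (s : State) (a : ℕ) : crossSum d (s.setOf n a) (s.setOf n a) =
    ∑ i ∈ Finset.range n, if s.arr a i ≠ 0 then
      ∑ j ∈ Finset.range n, (if s.arr a j ≠ 0 then distOracle d i j else 0) else 0 := by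
  rw [← Fin.sum_univ_eq_sum_range (fun i => if s.arr a i ≠ 0 then
      ∑ j ∈ Finset.range n, (if s.arr a j ≠ 0 then distOracle d i j else 0) else 0), crossSum,
    State.setOf, Finset.sum_filter]
  refine Finset.sum_congr rfl fun i _ => ?_
  rw [Finset.sum_filter, ← Fin.sum_univ_eq_sum_range
    (fun j => if s.arr a j ≠ 0 then distOracle d i j else 0)]
  simp [distOracle]

lemma runs_sumRow {s : State} (h0 : s.nat 0 = n) (h1 : s.nat 1 = 1) (h18 : s.nat 18 = 0) :
    Runs d M₁ M₂ sumRow (6 * n + 2) s fun s' =>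
      Frame 16 3 s s' ∧ s'.nat 18 = 0 ∧ s'.arr = s.arr ∧
        s'.real 3 = s.real 3 + ∑ j ∈ Finset.range n,
          if s.arr 1 j ≠ 0 then distOracle d (s.nat 15) j else 0 := by
  refine (Runs.seq (t := 1) (t' := n * (5 + 1) + 1) (Runs.block _ _ ?_) fun s' hs' =>
    (Runs.loop n (fun k s' => s'.nat 16 = k ∧ Frame 16 3 s s' ∧ s'.nat 18 = 0 ∧ s'.arr = s.arr ∧
      s'.real 3 = s.real 3 + ∑ j ∈ Finset.range k,
          if s.arr 1 j ≠ 0 then distOracle d (s.nat 15) j else 0) hs' ?_ ?_).mono le_rfl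
      fun s' h => h.2).mono (by omega) fun _ h => h
  · refine ⟨by simp [Instr.run], ⟨fun y hy => ?_, fun y _ => by simp [Instr.run]⟩,
      by simp [Instr.run, h18], by simp [Instr.run], by simp [Instr.run]⟩
    simp [Instr.run, hy.ne]
  · rintro k hk s' ⟨h16, hF, h18', harr, hr⟩
    have e0 := hF.1 0 (by omega)
    have e1 := hF.1 1 (by omega)
    have e15 := hF.1 15 (by omega)
    refine ⟨by simp only [Test.holds]; omega, Runs.seq (t := 1) (t' := 4)
      (R := fun s'' => s''.nat 17 = s.arr 1 k ∧ s''.nat 16 = k ∧ Frame 16 3 s s'' ∧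
        s''.nat 18 = 0 ∧ s''.arr = s.arr ∧ s''.real 3 = s'.real 3) (Runs.block _ _ ?_) ?_⟩
    · refine ⟨by simp [Instr.run, h16, harr], by simp [Instr.run, h16], ⟨fun y hy => ?_,
        fun y hy => by simp [Instr.run, hF.2 y hy]⟩, by simp [Instr.run, h18'],
        by simp [Instr.run, harr], by simp [Instr.run]⟩
      have g17 : y ≠ 17 := by omega
      simp [Instr.run, g17, hF.1 y hy]
    rintro u ⟨u17, u16, uF, u18, uarr, ur⟩
    refine Runs.seq (t := 3) (t' := 1) (R := fun s'' => s''.nat 16 = k ∧ Frame 16 3 s s'' ∧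
      s''.nat 18 = 0 ∧ s''.arr = s.arr ∧ s''.real 3 = s.real 3 + ∑ j ∈ Finset.range (k + 1),
          if s.arr 1 j ≠ 0 then distOracle d (s.nat 15) j else 0)
      (Runs.ite (t := 2) (fun hc => Runs.block _ _ ?_)
        (fun hc => (Runs.block _ _ ?_).mono (by simp) fun _ h => h)) ?_
    · simp only [Test.holds, u17, u18] at hc
      have u15 := uF.1 15 (by omega)
      refine ⟨by simp [Instr.run, u16], ⟨fun y hy => ?_, fun y hy => ?_⟩,
        by simp [Instr.run, u18], by simp [Instr.run, uarr], ?_⟩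
      · simp [Instr.run, uF.1 y hy]
      · have g3 : y ≠ 3 := by omega
        have g4 : y ≠ 4 := by omega
        simp [Instr.run, g3, g4, uF.2 y hy]
      · rw [Finset.sum_range_succ, if_pos hc.ne', ← add_assoc, ← hr]
        simp [Instr.run, ur, u15, u16]
    · simp only [Test.holds, u17, u18, not_lt, Nat.le_zero] at hc
      refine ⟨by simp [Instr.run, u16], ⟨fun y hy => ?_, fun y hy => ?_⟩,
        by simp [Instr.run, u18], by simp [Instr.run, uarr], ?_⟩
      · have g17 : y ≠ 17 := by omega
        simp [Instr.run, g17, uF.1 y hy]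
      · simp [Instr.run, uF.2 y hy]
      · rw [Finset.sum_range_succ, if_neg (by simp [hc]), add_zero, ← hr]
        simp [Instr.run, ur]
    · rintro w ⟨w16, wF, w18, warr, wr⟩
      have f1 := wF.1 1 (by omega)
      refine Runs.block _ _ ⟨by simp [Instr.run, w16, f1, h1], ⟨fun y hy => ?_,
        fun y hy => by simp [Instr.run, wF.2 y hy]⟩, by simp [Instr.run, w18],
        by simp [Instr.run, warr], by simp only [List.foldl, Instr.run]; exact wr⟩
      simp [Instr.run, hy.ne, wF.1 y hy]
  · rintro s' ⟨h16, hF, -⟩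
    have e0 := hF.1 0 (by omega)
    simp only [Test.holds]
    omega

lemma runs_evaluate {s : State} (h0 : s.nat 0 = n) (h1 : s.nat 1 = 1) :
    Runs d M₁ M₂ evaluate (n * (6 * n + 6) + 4) s fun s' =>
      Frame 15 3 s s' ∧ s'.arr = s.arr ∧
        s'.real 3 = crossSum d (s.setOf n 1) (s.setOf n 1) := by
  rw [crossSum_setOf]
  set row : ℕ → ℝ := fun i => if s.arr 1 i ≠ 0 then
      ∑ j ∈ Finset.range n, (if s.arr 1 j ≠ 0 then distOracle d i j else 0) else 0 with hrow
  refine (Runs.seq (t := 3) (t' := n * (6 * n + 5 + 1) + 1) (Runs.block _ _ ?_) fun s' hs' =>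
    (Runs.loop n (fun k s' => s'.nat 15 = k ∧ s'.nat 18 = 0 ∧ Frame 15 3 s s' ∧ s'.arr = s.arr ∧
      s'.real 3 = ∑ i ∈ Finset.range k, row i) hs' ?_ ?_).mono le_rfl
      fun s' h => h.2.2).mono (by rw [show 6 * n + 5 + 1 = 6 * n + 6 by omega]; omega) fun _ h => h
  · refine ⟨by simp [Instr.run], by simp [Instr.run], ⟨fun y hy => ?_, fun y hy => ?_⟩,
      by simp [Instr.run], by simp [Instr.run]⟩
    · have g18 : y ≠ 18 := by omega
      simp [Instr.run, hy.ne, g18]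
    · simp [Instr.run, hy.ne]
  · rintro k hk s' ⟨h15, h18, hF, harr, hr⟩
    have e0 := hF.1 0 (by omega)
    have e1 := hF.1 1 (by omega)
    refine ⟨by simp only [Test.holds]; omega, (Runs.seq (t := 1) (t' := 6 * n + 4)
      (R := fun s'' => s''.nat 17 = s.arr 1 k ∧ s''.nat 15 = k ∧ s''.nat 18 = 0 ∧
        Frame 15 3 s s'' ∧ s''.arr = s.arr ∧ s''.real 3 = s'.real 3) (Runs.block _ _ ?_)
        ?_).mono (by omega) fun _ h => h⟩
    · refine ⟨by simp [Instr.run, h15, harr], by simp [Instr.run, h15], by simp [Instr.run, h18],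
        ⟨fun y hy => ?_, fun y hy => by simp [Instr.run, hF.2 y hy]⟩,
        by simp [Instr.run, harr], by simp [Instr.run]⟩
      have g17 : y ≠ 17 := by omega
      simp [Instr.run, g17, hF.1 y hy]
    rintro u ⟨u17, u15, u18, uF, uarr, ur⟩
    have f0 := uF.1 0 (by omega)
    have f1 := uF.1 1 (by omega)
    refine Runs.seq (t := 6 * n + 3) (t' := 1) (R := fun s'' => s''.nat 15 = k ∧ s''.nat 18 = 0 ∧
      Frame 15 3 s s'' ∧ s''.arr = s.arr ∧ s''.real 3 = ∑ i ∈ Finset.range (k + 1), row i)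
      (Runs.ite (t := 6 * n + 2)
        (fun hc => (runs_sumRow (f0.trans h0) (f1.trans h1) u18).mono le_rfl ?_)
        (fun hc => (Runs.block _ _ ?_).mono (by simp) fun _ h => h)) ?_
    · rintro w ⟨wF, w18, warr, wr⟩
      simp only [Test.holds, u17, u18] at hc
      refine ⟨(wF.1 15 (by omega)).trans u15, w18, uF.trans (wF.mono (by omega) le_rfl),
        warr.trans uarr, ?_⟩
      rw [wr, ur, hr, Finset.sum_range_succ, uarr, u15]
      simp only [hrow, if_pos hc.ne']
    · simp only [Test.holds, u17, u18, not_lt, Nat.le_zero] at hc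
      refine ⟨by simp [Instr.run, u15], by simp [Instr.run, u18], ⟨fun y hy => ?_, fun y hy => ?_⟩,
        by simp [Instr.run, uarr], ?_⟩
      · have g17 : y ≠ 17 := by omega
        simp [Instr.run, g17, uF.1 y hy]
      · simp [Instr.run, uF.2 y hy]
      · rw [Finset.sum_range_succ, ← hr]
        simp [Instr.run, ur, hrow, hc]
    · rintro w ⟨w15, w18, wF, warr, wr⟩
      have f1 := wF.1 1 (by omega)
      refine Runs.block _ _ ⟨by simp [Instr.run, w15, f1, h1], by simp [Instr.run, w18],
        ⟨fun y hy => ?_, fun y hy => by simp [Instr.run, wF.2 y hy]⟩,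
        by simp [Instr.run, warr], by simp only [List.foldl, Instr.run]; exact wr⟩
      simp [Instr.run, hy.ne, wF.1 y hy]
  · rintro s' ⟨h15, -, hF, -⟩
    have e0 := hF.1 0 (by omega)
    simp only [Test.holds]
    omega

/-- The set in array `2` is feasible and its value is in real register `2`. -/
def BestRecorded (d : Fin n → Fin n → ℝ) (M₁ M₂ : Matroid (Fin n)) (s : State) : Prop :=
  CommonIndep M₁ M₂ (s.setOf n 2) ∧ s.real 2 = crossSum d (s.setOf n 2) (s.setOf n 2)

lemma BestRecorded.congr {s s' : State} (h : BestRecorded d M₁ M₂ s) (ha : s'.arr 2 = s.arr 2)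
    (hr : s'.real 2 = s.real 2) : BestRecorded d M₁ M₂ s' := by
  have : s'.setOf n 2 = s.setOf n 2 := by simp only [State.setOf, ha]
  rw [BestRecorded, this, hr]
  exact h

/-- The parameters of the search are in their registers. -/
structure Parameters (n K N : ℕ) (s : State) : Prop where
  nat0 : s.nat 0 = n
  nat1 : s.nat 1 = 1
  nat2 : s.nat 2 = K
  nat3 : s.nat 3 = n + 1
  nat4 : s.nat 4 = N

lemma Parameters.of_frame {K N b r : ℕ} {s s' : State} (h : Parameters n K N s)
    (hF : Frame b r s s') (hb : 5 ≤ b) : Parameters n K N s' where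
  nat0 := (hF.1 0 (by omega)).trans h.nat0
  nat1 := (hF.1 1 (by omega)).trans h.nat1
  nat2 := (hF.1 2 (by omega)).trans h.nat2
  nat3 := (hF.1 3 (by omega)).trans h.nat3
  nat4 := (hF.1 4 (by omega)).trans h.nat4

/-- A time bound for `tryNeighbour`. -/
def tryTime (n K N : ℕ) : ℕ := n * (6 * n + 6) + 8 * n + toggleTime K N + 15

/-- The neighbour encoded by register `6` is taken into account in the record of the best set. -/
lemma runs_tryNeighbour {s : State} {K N : ℕ} (hs : Parameters n K N s) (h6 : s.nat 6 ≤ N)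
    (hbest : BestRecorded d M₁ M₂ s) :
    Runs d M₁ M₂ tryNeighbour (tryTime n K N) s fun s' =>
      Frame 6 2 s s' ∧ s'.nat 6 = s.nat 6 + 1 ∧ s'.arr 0 = s.arr 0 ∧ BestRecorded d M₁ M₂ s' ∧
        s.real 2 ≤ s'.real 2 ∧
        (CommonIndep M₁ M₂ (symmDiff (s.setOf n 0) (digitSet n K (s.nat 6))) →
          crossSum d (symmDiff (s.setOf n 0) (digitSet n K (s.nat 6)))
            (symmDiff (s.setOf n 0) (digitSet n K (s.nat 6))) ≤ s'.real 2) := by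
  set C := symmDiff (s.setOf n 0) (digitSet n K (s.nat 6)) with hC
  refine (Runs.seq (runs_copyArr (by norm_num) hs.nat0 hs.nat1) ?_).mono
    (t := (4 * n + 2) + (toggleTime K N + (3 + (((n * (6 * n + 6) + 4) +
      (((4 * n + 2) + 1) + 1) + 1) + 1)))) (by rw [tryTime]; omega) fun _ h => h
  rintro s₁ ⟨hF₁, harr₁, hcopy₁⟩
  have p₁ := hs.of_frame hF₁ (by omega)
  have g₁ := hF₁.1 6 (by omega)
  refine Runs.seq (runs_toggleDigits p₁.nat0 p₁.nat1 p₁.nat2 p₁.nat3 (g₁.trans_le h6)) ?_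
  rintro s₂ ⟨hF₂, harr₂, htog₂⟩
  have hset : s₂.setOf n 1 = C := by
    ext v
    rw [mem_setOf, htog₂, toggleArr_ne_zero_iff, g₁, hcopy₁ v v.2, hC, Finset.mem_symmDiff,
      mem_setOf]
    rfl
  have hF₂' : Frame 7 4 s s₂ := (hF₁.mono (by omega) le_rfl).trans hF₂
  have ha0 : s₂.arr 0 = s.arr 0 := (harr₂ 0 (by norm_num)).trans (harr₁ 0 (by norm_num))
  have ha2 : s₂.arr 2 = s.arr 2 := (harr₂ 2 (by norm_num)).trans (harr₁ 2 (by norm_num))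
  refine Runs.seq (t := 3) (R := fun u => Frame 7 4 s u ∧ u.arr = s₂.arr ∧
    u.nat 13 = indepOracle M₁ C + indepOracle M₂ C) (Runs.block _ _ ?_) ?_
  · refine ⟨⟨fun y hy => ?_, fun y hy => by simp [Instr.run, hF₂'.2 y hy]⟩, by simp [Instr.run],
      ?_⟩
    · have g13 : y ≠ 13 := by omega
      have g14 : y ≠ 14 := by omega
      simp [Instr.run, g13, g14, hF₂'.1 y hy]
    · have hset' : ∀ u : State, u.arr = s₂.arr → u.setOf n 1 = C := fun u hu => by
        rw [← hset]
        simp only [State.setOf, hu]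
      simp [Instr.run, hset, hset']
  rintro s₃ ⟨hF₃, harr₃, h13⟩
  have p₃ := hs.of_frame hF₃ (by omega)
  have hset₃ : s₃.setOf n 1 = C := by rw [← hset]; simp only [State.setOf, harr₃]
  have hbest₃ : BestRecorded d M₁ M₂ s₃ :=
    hbest.congr (by rw [harr₃, ha2]) (hF₃.2 2 (by omega))
  refine Runs.seq (t' := 1) (R := fun u => Frame 7 2 s u ∧ u.arr 0 = s.arr 0 ∧
    BestRecorded d M₁ M₂ u ∧ s.real 2 ≤ u.real 2 ∧
    (CommonIndep M₁ M₂ C → crossSum d C C ≤ u.real 2)) (Runs.ite (fun hc => ?_) (fun hc => ?_)) ?_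
  · have hfeas : CommonIndep M₁ M₂ C := by
      simp only [Test.holds, p₃.nat1, h13, indepOracle] at hc
      constructor
      · by_contra hn
        rw [if_neg hn] at hc
        split_ifs at hc <;> omega
      · by_contra hn
        rw [if_neg hn] at hc
        split_ifs at hc <;> omega
    refine Runs.seq (runs_evaluate p₃.nat0 p₃.nat1) ?_
    rintro s₄ ⟨hF₄, harr₄, hval⟩
    rw [hset₃] at hval
    have p₄ := p₃.of_frame hF₄ (by omega)
    have hF₄' : Frame 7 3 s s₄ := (hF₃.mono le_rfl (by omega)).trans (hF₄.mono (by omega) le_rfl)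
    have hset₄ : s₄.setOf n 1 = C := by rw [← hset₃]; simp only [State.setOf, harr₄]
    have hbest₄ : BestRecorded d M₁ M₂ s₄ := hbest₃.congr (by rw [harr₄]) (hF₄.2 2 (by omega))
    refine Runs.ite (fun hc' => ?_) (fun hc' => ?_)
    · refine Runs.seq (t := 4 * n + 2) (t' := 1) (runs_copyArr (by norm_num) p₄.nat0 p₄.nat1) ?_
      rintro s₅ ⟨hF₅, harr₅, hcopy₅⟩
      have hF₅' : Frame 7 3 s s₅ := hF₄'.trans (hF₅.mono (by omega) (by omega))
      have hset₅ : s₅.setOf n 2 = C := by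
        ext v
        rw [mem_setOf, hcopy₅ v v.2, ← mem_setOf, hset₄]
      have hr3 : s₅.real 3 = crossSum d C C := (hF₅.2 3 (by omega)).trans hval
      have hr2 : s₄.real 2 = s.real 2 := hF₄'.2 2 (by omega)
      simp only [Test.holds, hval, hr2] at hc'
      refine Runs.block _ _ ⟨⟨fun y hy => ?_, fun y hy => ?_⟩, ?_, ?_, ?_, ?_⟩
      · simp [Instr.run, hF₅'.1 y hy]
      · simp [Instr.run, hy.ne, hF₅'.2 y (by omega)]
      · simp [Instr.run, harr₅ 0 (by norm_num), harr₄, harr₃, ha0]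
      · have hset₆ : ∀ u : State, u.arr = s₅.arr → u.setOf n 2 = C := fun u hu => by
          rw [← hset₅]
          simp only [State.setOf, hu]
        rw [BestRecorded, hset₆ _ (by simp [Instr.run])]
        exact ⟨hfeas, by simp [Instr.run, hr3]⟩
      · simp only [List.foldl, Instr.run, Function.update_self, hr3]
        exact hc'.le
      · intro _
        simp [Instr.run, hr3]
    · have hr2 : s₄.real 2 = s.real 2 := hF₄'.2 2 (by omega)
      simp only [Test.holds, hval, not_lt] at hc'
      refine (Runs.block _ _ ?_).mono (by simp) fun _ h => h
      refine ⟨⟨fun y hy => ?_, fun y hy => ?_⟩, ?_, hbest₄.congr ?_ ?_, ?_, fun _ => ?_⟩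
      · have g17 : y ≠ 17 := by omega
        simp [Instr.run, g17, hF₄'.1 y hy]
      · simp [Instr.run, hF₄'.2 y (by omega)]
      · simp [Instr.run, harr₄, harr₃, ha0]
      · simp [Instr.run]
      · simp [Instr.run]
      · simp [Instr.run, hr2]
      · simp only [List.foldl, Instr.run]
        exact hc'
  · have hinf : ¬ CommonIndep M₁ M₂ C := by
      intro hf
      refine hc ?_
      simp only [Test.holds, p₃.nat1, h13, indepOracle, if_pos hf.1, if_pos hf.2]
      norm_num
    have hr2 : s₃.real 2 = s.real 2 := hF₃.2 2 (by omega)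
    refine (Runs.block _ _ ?_).mono (by simp; omega) fun _ h => h
    refine ⟨⟨fun y hy => ?_, fun y hy => ?_⟩, ?_, hbest₃.congr ?_ ?_, ?_,
      fun hf => absurd hf hinf⟩
    · have g17 : y ≠ 17 := by omega
      simp [Instr.run, g17, hF₃.1 y hy]
    · simp [Instr.run, hF₃.2 y (by omega)]
    · simp [Instr.run, harr₃, ha0]
    · simp [Instr.run]
    · simp [Instr.run]
    · simp [Instr.run, hr2]
  · rintro u ⟨hF, ha, hb, hle, hval⟩
    have p := hs.of_frame hF (by omega)
    refine Runs.block _ _ ⟨⟨fun y hy => ?_, fun y hy => by simp [Instr.run, hF.2 y hy]⟩, ?_,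
      by simp [Instr.run, ha], hb.congr (by simp [Instr.run]) (by simp [Instr.run]),
      by simp only [List.foldl, Instr.run]; exact hle,
      by simp only [List.foldl, Instr.run]; exact hval⟩
    · simp [Instr.run, hy.ne, hF.1 y (by omega)]
    · simp [Instr.run, p.nat1, hF.1 6 (by omega)]

/-- A time bound for `searchRound`. -/
def roundTime (n K N : ℕ) : ℕ := N * (tryTime n K N + 1) + 4 * n + 5

/-- One round moves to a set which is at least as good as all neighbours. -/
lemma runs_searchRound {s : State} {K : ℕ} (hs : Parameters n K ((n + 1) ^ K) s)
    (hbest : BestRecorded d M₁ M₂ s) :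
    Runs d M₁ M₂ searchRound (roundTime n K ((n + 1) ^ K)) s fun s' =>
      Frame 5 2 s s' ∧ s'.nat 5 = s.nat 5 + 1 ∧ BestRecorded d M₁ M₂ s' ∧
        CommonIndep M₁ M₂ (s'.setOf n 0) ∧
        ∀ C, CommonIndep M₁ M₂ C → (symmDiff (s.setOf n 0) C).card ≤ K →
          crossSum d C C ≤ crossSum d (s'.setOf n 0) (s'.setOf n 0) := by
  set N := (n + 1) ^ K with hN
  refine (Runs.seq (t := 1) (R := fun u => Frame 6 2 s u ∧ u.nat 6 = 0 ∧ u.arr 0 = s.arr 0 ∧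
    BestRecorded d M₁ M₂ u) (Runs.block _ _ ?_) ?_).mono
    (t' := roundTime n K N) (t := 1 + ((N * (tryTime n K N + 1) + 1) + ((4 * n + 2) + 1)))
    (by rw [roundTime]; omega) fun _ h => h
  · refine ⟨⟨fun y hy => by simp [Instr.run, hy.ne], fun y _ => by simp [Instr.run]⟩,
      by simp [Instr.run], by simp [Instr.run],
      hbest.congr (by simp [Instr.run]) (by simp [Instr.run])⟩
  rintro u ⟨uF, u6, u0, ubest⟩
  refine Runs.seq (Runs.loop N (fun k w => Frame 6 2 s w ∧ w.nat 6 = k ∧ w.arr 0 = s.arr 0 ∧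
    BestRecorded d M₁ M₂ w ∧ ∀ x < k,
      CommonIndep M₁ M₂ (symmDiff (s.setOf n 0) (digitSet n K x)) →
        crossSum d (symmDiff (s.setOf n 0) (digitSet n K x))
          (symmDiff (s.setOf n 0) (digitSet n K x)) ≤ w.real 2)
    ⟨uF, u6, u0, ubest, by simp⟩ ?_ ?_) ?_
  · rintro k hk w ⟨wF, w6, w0, wbest, wall⟩
    have p := hs.of_frame wF (by omega)
    have hw0 : w.setOf n 0 = s.setOf n 0 := by simp only [State.setOf, w0]
    refine ⟨by simp only [Test.holds, w6, p.nat4]; exact hk,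
      (runs_tryNeighbour p (w6.trans_le hk.le) wbest).mono le_rfl ?_⟩
    rintro z ⟨zF, z6, z0, zbest, zle, zval⟩
    rw [hw0, w6] at zval
    refine ⟨wF.trans zF, by rw [z6, w6], z0.trans w0, zbest, fun x hx hf => ?_⟩
    rcases Nat.lt_succ_iff_lt_or_eq.1 hx with hx | rfl
    · exact (wall x hx hf).trans zle
    · exact zval hf
  · rintro w ⟨wF, w6, -⟩
    have p := hs.of_frame wF (by omega)
    simp only [Test.holds, w6, p.nat4]
    omega
  · rintro w ⟨wF, w6, w0, wbest, wall⟩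
    have p := hs.of_frame wF (by omega)
    refine Runs.seq (runs_copyArr (by norm_num) p.nat0 p.nat1) ?_
    rintro z ⟨zF, zarr, zcopy⟩
    have hz : z.setOf n 0 = w.setOf n 2 := by
      ext v
      rw [mem_setOf, zcopy v v.2, mem_setOf]
    have zbest : BestRecorded d M₁ M₂ z := wbest.congr (zarr 2 (by norm_num)) (zF.2 2 (by omega))
    have pz := p.of_frame zF (by omega)
    have hF : Frame 6 2 s z := wF.trans (zF.mono (by omega) (by omega))
    have hset : ∀ q : State, q.arr = z.arr → q.setOf n 0 = w.setOf n 2 := fun q hq => by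
      rw [← hz]
      simp only [State.setOf, hq]
    refine Runs.block _ _ ⟨⟨fun y hy => ?_, fun y hy => ?_⟩, ?_, zbest.congr ?_ ?_, ?_, ?_⟩
    · simp [Instr.run, hy.ne, hF.1 y (by omega)]
    · simp [Instr.run, hF.2 y hy]
    · simp [Instr.run, pz.nat1, hF.1 5 (by omega)]
    · simp [Instr.run]
    · simp [Instr.run]
    · rw [hset _ (by simp [Instr.run])]
      exact wbest.1
    · intro C hCI hcard
      rw [hset _ (by simp [Instr.run]), ← wbest.2]
      obtain ⟨x, hx, hxD⟩ := exists_digitSet_eq K _ hcard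
      have h1 := wall x hx
      rw [hxD, symmDiff_symmDiff_cancel_left] at h1
      exact h1 hCI

lemma runs_setRadius {ε : ℝ} {p : ℕ} (hp : 8 ≤ p * ε) (hmin : ∀ k < p, k * ε < 8) :
    Runs d M₁ M₂ setRadius (4 * p + 8) (initState n ε) fun s' =>
      s'.nat 0 = n ∧ s'.nat 1 = 1 ∧ s'.nat 2 = 6 * p * (p + 1) ∧ s'.real 2 = 0 ∧
        s'.arr = fun _ _ => 0 := by
  refine (Runs.seq (t := 7) (t' := p * (3 + 1) + 1) (Runs.block _ _ ?_) fun s' hs' =>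
    (Runs.loop p (fun k s' => s'.nat 0 = n ∧ s'.nat 1 = 1 ∧ s'.nat 2 = 6 * k * (k + 1) ∧
      s'.nat 7 = 12 * k ∧ s'.nat 8 = 12 ∧ s'.real 0 = ε ∧ s'.real 1 = 8 ∧ s'.real 2 = 0 ∧
      s'.real 3 = k * ε ∧ s'.arr = fun _ _ => 0) hs' ?_ ?_).mono le_rfl fun s' h => ?_).mono
      (by omega) fun _ h => h
  · simp [Instr.run, initState]
    norm_num
  · rintro k hk s' ⟨e0, e1, e2, e7, e8, r0, r1, r2, r3, ha⟩
    refine ⟨by simp only [Test.holds, r3, r1]; exact hmin k hk, Runs.block _ _ ?_⟩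
    simp [Instr.run, e0, e1, e2, e7, e8, r0, r1, r2, r3, ha]
    exact ⟨by ring, by ring, by ring⟩
  · rintro s' ⟨e0, e1, e2, e7, e8, r0, r1, r2, r3, ha⟩
    simp only [Test.holds, r3, r1, not_lt]
    exact hp
  · obtain ⟨e0, e1, e2, -, -, -, -, r2, -, ha⟩ := h
    exact ⟨e0, e1, e2, r2, ha⟩

lemma runs_setPower {K : ℕ} {s : State} (h0 : s.nat 0 = n) (h1 : s.nat 1 = 1)
    (h2 : s.nat 2 = K) :
    Runs d M₁ M₂ setPower (K * (3 * n + 9) + 4) s fun s' =>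
      Parameters n K ((n + 1) ^ K) s' ∧ s'.arr = s.arr ∧ s'.real = s.real := by
  refine (Runs.seq (t := 3) (t' := K * (3 * n + 8 + 1) + 1) (Runs.block _ _ ?_) fun s' hs' =>
    (Runs.loop K (fun k s' => Parameters n K ((n + 1) ^ k) s' ∧ s'.nat 9 = k ∧ s'.arr = s.arr ∧
      s'.real = s.real) hs' ?_ ?_).mono le_rfl fun s' h => ⟨h.1, h.2.2⟩).mono
      (by rw [show 3 * n + 8 + 1 = 3 * n + 9 by omega]; omega) fun _ h => h
  · refine ⟨⟨?_, ?_, ?_, ?_, ?_⟩, ?_, ?_, ?_⟩ <;> simp [Instr.run, h0, h1, h2]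
  · rintro k hk s' ⟨hp, h9, ha, hr⟩
    have := hp.nat0; have := hp.nat1; have := hp.nat2; have := hp.nat3; have := hp.nat4
    refine ⟨by simp only [Test.holds, h9, hp.nat2]; exact hk, (Runs.seq (t := 2)
      (R := fun u => Parameters n K ((n + 1) ^ k) u ∧ u.nat 9 = k ∧ u.nat 10 = 0 ∧ u.nat 11 = 0 ∧
        u.arr = s.arr ∧ u.real = s.real) (Runs.block _ _ ?_) ?_).mono
        (t := 2 + (((n + 1) * (2 + 1) + 1) + 2)) (by omega) fun _ h => h⟩
    · refine ⟨⟨?_, ?_, ?_, ?_, ?_⟩, ?_, ?_, ?_, ?_, ?_⟩ <;> simp [Instr.run, *]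
    rintro u ⟨up, u9, u10, u11, ua, ur⟩
    refine Runs.seq (Runs.loop (n + 1) (fun j w => Parameters n K ((n + 1) ^ k) w ∧ w.nat 9 = k ∧
      w.nat 10 = j * (n + 1) ^ k ∧ w.nat 11 = j ∧ w.arr = s.arr ∧ w.real = s.real)
      ⟨up, u9, by simpa using u10, u11, ua, ur⟩ ?_ ?_) ?_
    · rintro j hj w ⟨wp, w9, w10, w11, wa, wr⟩
      have := wp.nat0; have := wp.nat1; have := wp.nat2; have := wp.nat3; have := wp.nat4
      refine ⟨by simp only [Test.holds, w11, wp.nat3]; exact hj, Runs.block _ _ ?_⟩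
      refine ⟨⟨?_, ?_, ?_, ?_, ?_⟩, ?_, ?_, ?_, ?_, ?_⟩ <;> simp [Instr.run, *]
      ring
    · rintro w ⟨wp, -, -, w11, -⟩
      simp only [Test.holds, w11, wp.nat3]
      omega
    · rintro w ⟨wp, w9, w10, w11, wa, wr⟩
      have := wp.nat0; have := wp.nat1; have := wp.nat2; have := wp.nat3
      refine Runs.block _ _ ?_
      refine ⟨⟨?_, ?_, ?_, ?_, ?_⟩, ?_, ?_, ?_⟩ <;> simp [Instr.run, *]
      ring
  · rintro s' ⟨hp, h9, -⟩
    simp only [Test.holds, h9, hp.nat2]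
    omega

/-- The number of rounds is sufficient. -/
lemma mul_cube_lt_pow {n K : ℕ} (hK : 6 ≤ K) : K * n ^ 3 < (n + 1) ^ K := by
  rcases Nat.eq_zero_or_pos n with rfl | hn
  · simp
  obtain ⟨j, rfl⟩ := Nat.exists_eq_add_of_le hK
  have h1 : 6 + j ≤ 2 ^ (j + 3) := by
    have := Nat.lt_two_pow_self (n := j)
    rw [pow_add]
    omega
  calc (6 + j) * n ^ 3 < (6 + j) * (n + 1) ^ 3 := by
        refine Nat.mul_lt_mul_of_pos_left ?_ (by omega)
        exact Nat.pow_lt_pow_left (Nat.lt_succ_self n) (by norm_num)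
    _ ≤ 2 ^ (j + 3) * (n + 1) ^ 3 := Nat.mul_le_mul_right _ h1
    _ ≤ (n + 1) ^ (j + 3) * (n + 1) ^ 3 :=
        Nat.mul_le_mul_right _ (Nat.pow_le_pow_left (by omega) _)
    _ = (n + 1) ^ (6 + j) := by ring

/-- A time bound for `approximationScheme`. -/
def schemeTime (n p K N : ℕ) : ℕ :=
  4 * p + 8 + (K * (3 * n + 9) + 4 + (1 + (N * (roundTime n K N + 1) + 1)))

lemma runs_approximationScheme (hd : IsDistance d) (hneg : IsNegativeType d)
    (hE₁ : M₁.E = Set.univ) (hE₂ : M₂.E = Set.univ) {ε : ℝ} {p : ℕ} (hp : 8 ≤ p * ε)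
    (hmin : ∀ k < p, k * ε < 8) :
    Runs d M₁ M₂ approximationScheme
      (schemeTime n p (6 * p * (p + 1)) ((n + 1) ^ (6 * p * (p + 1)))) (initState n ε)
      fun s' => IsApproxSolution d M₁ M₂ ε (s'.output n) := by
  have hp0 : 0 < p := by
    rcases Nat.eq_zero_or_pos p with rfl | h
    · norm_num at hp
    · exact h
  set K := 6 * p * (p + 1) with hK
  have hK6 : 6 ≤ K := by rw [hK]; nlinarith
  refine Runs.seq (runs_setRadius hp hmin) ?_
  rintro s₁ ⟨e0, e1, e2, r2, ha⟩
  refine Runs.seq (runs_setPower e0 e1 e2) ?_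
  rintro s₂ ⟨hp₂, ha₂, hr₂⟩
  have hempty : ∀ (s : State) (a : ℕ), s.arr = (fun _ _ => 0) → s.setOf n a = ∅ := by
    intro s a h
    simp [State.setOf, h]
  refine Runs.seq (t := 1) (R := fun u => Parameters n K ((n + 1) ^ K) u ∧ u.nat 5 = 0 ∧
    u.real 2 = 0 ∧ u.arr = fun _ _ => 0) (Runs.block _ _ ?_) ?_
  · have := hp₂.nat0; have := hp₂.nat1; have := hp₂.nat2; have := hp₂.nat3; have := hp₂.nat4
    refine ⟨⟨?_, ?_, ?_, ?_, ?_⟩, ?_, ?_, ?_⟩ <;> simp [Instr.run, *]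
  rintro s₃ ⟨hp₃, h5, hr₃, ha₃⟩
  refine (Runs.loop ((n + 1) ^ K) (fun k u => Parameters n K ((n + 1) ^ K) u ∧ u.nat 5 = k ∧
    BestRecorded d M₁ M₂ u ∧ LocalSearch d M₁ M₂ K k (u.setOf n 0)) ⟨hp₃, h5, ?_, ?_⟩ ?_
    ?_).mono le_rfl ?_
  · rw [BestRecorded, hempty _ _ ha₃, hr₃]
    simp [CommonIndep, crossSum]
  · rw [hempty _ _ ha₃]
    exact .zero
  · rintro k hk u ⟨up, u5, ubest, uls⟩
    refine ⟨by simp only [Test.holds, u5, up.nat4]; exact hk,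
      (runs_searchRound up ubest).mono le_rfl ?_⟩
    rintro w ⟨wF, w5, wbest, wI, wall⟩
    exact ⟨up.of_frame wF le_rfl, by rw [w5, u5], wbest, .succ uls wI wall⟩
  · rintro u ⟨up, u5, -⟩
    simp only [Test.holds, u5, up.nat4]
    omega
  · rintro u ⟨-, -, -, uls⟩
    have hlt := mul_cube_lt_pow (n := n) hK6
    rw [← Nat.sub_add_cancel (Nat.one_le_of_lt hlt)] at uls
    refine uls.isApproxSolution hd hneg hE₁ hE₂ hp0 hp ?_
    rw [Fintype.card_fin, ← hK]
    omega

end Verification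

end MaxSumDiv

theorem theorem2 :
    ∃ P : MaxSumDiv.Prog, ∀ ε : ℝ, 0 < ε → ∃ T : Polynomial ℕ,
      ∀ (n : ℕ) (d : Fin n → Fin n → ℝ) (M₁ M₂ : Matroid (Fin n)),
        MaxSumDiv.IsDistance d → MaxSumDiv.IsNegativeType d →
        M₁.E = Set.univ → M₂.E = Set.univ →
        ∃ (s : MaxSumDiv.State) (t : ℕ),
          MaxSumDiv.Exec d M₁ M₂ P (MaxSumDiv.initState n ε) s t ∧
          t ≤ T.eval n ∧
          MaxSumDiv.IsApproxSolution d M₁ M₂ ε (s.output n) := by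
  refine ⟨MaxSumDiv.approximationScheme, fun ε hε => ?_⟩
  have hex : ∃ p : ℕ, 8 ≤ p * ε := by
    obtain ⟨p, hp⟩ := exists_nat_ge (8 / ε)
    exact ⟨p, (div_le_iff₀ hε).1 hp⟩
  classical
  set p := Nat.find hex with hp
  set K := 6 * p * (p + 1) with hK
  -- The time bound `schemeTime n p K ((n + 1) ^ K)` as a polynomial in `n`.
  have hT : ∃ T : Polynomial ℕ, ∀ n, T.eval n = MaxSumDiv.schemeTime n p K ((n + 1) ^ K) := by
    let X : Polynomial ℕ := Polynomial.X
    let N : Polynomial ℕ := (X + 1) ^ K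
    refine ⟨4 * (p : Polynomial ℕ) + 8 + ((K : Polynomial ℕ) * (3 * X + 9) + 4 + (1 + (N * ((N *
      (X * (6 * X + 6) + 8 * X + ((K : Polynomial ℕ) * (3 * N + 8) + 3) + 15 + 1) +
        4 * X + 5) + 1) + 1))), fun n => ?_⟩
    simp [X, N, MaxSumDiv.schemeTime, MaxSumDiv.roundTime, MaxSumDiv.tryTime,
      MaxSumDiv.toggleTime]
  obtain ⟨T, hT⟩ := hT
  refine ⟨T, fun n d M₁ M₂ hd hneg hE₁ hE₂ => ?_⟩
  obtain ⟨s, t, he, ht, hs⟩ := MaxSumDiv.runs_approximationScheme (d := d) hd hneg hE₁ hE₂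
    (Nat.find_spec hex) (fun k hk => not_le.1 (Nat.find_min hex hk))
  exact ⟨s, t, he, by rw [hT]; exact ht, hs⟩
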